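/- For $\alpha,\beta>0$ and $x\in\mathbb R$ let $E_{\alpha,\beta}(x)=\sum_{k\ge0}\frac{x^k}{\Gamma(\alpha k+\beta)}$ be the generalized Mittag-Leffler function. Let $d\ge3$ and $j\ge 0$ be integers and let $c,\lambda>0$. For $t>0$ and $n\ge1$ let $f_{n,t}$ be the generalized Dirichlet density $$f_{n,t}(\tau_1,\dots,\tau_n)=C_{n,t}\prod_{k=1}^n\Big[\tau_k^{a_k-1}\Big(t-\sum_{i=1}^k\tau_i\Big)^{b_k-1}\Big],\qquad 0<\tau_k<t-\sum_{i=1}^{k-1}\tau_i\quad(k=1,\dots,n),$$ $$C_{n,t}=\frac{1}{t^{\sum_{k=1}^n(a_k+b_k-1)}}\prod_{k=1}^n\frac{\Gamma\big(1+\sum_{i=k}^n(a_i+b_i-1)\big)}{\Gamma(a_k)\,\Gamma\big(b_k+\sum_{i=k+1}^n(a_i+b_i-1)\big)},$$ with $a_1=\dots=a_n=\frac d2-1$, $b_n=\frac d2-1$ and, for $k<n$, $b_k=2$ if $k=j$ and $b_k=1$ if $k\ne j$ (so $b=(1,\dots,1,\frac d2-1)$ if $j\ge n$). On a probability space, for every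 $t>0$, let $\mathcal N_d(t)$ be a random variable with the fractional Poisson law $$P(\mathcal N_d(t)=n)=\frac{1}{E_{\frac d2-1,\frac d2}(\lambda t)}\,\frac{(\lambda t)^n}{\Gamma\big(n(\frac d2-1)+\frac d2\big)},\qquad n\ge0,$$ and let $\tau_1(t),\tau_2(t),\dots$ be random variables such that, for every $n\ge1$, given $\mathcal N_d(t)=n$, the vector $(\tau_1(t),\dots,\tau_n(t))$ has density $f_{n,t}$. Let $V_1,V_2,\dots$ be independent random vectors, uniformly distributed on the unit sphere of $\mathbb R^d$, the sequence $(V_k)_k$ being, for every $t>0$, independent of $(\mathcal N_d(t),(\tau_k(t))_k)$. Let $Z_d^{2,j}(t)$ be the position at time $t$ of the walk with speed $c$, started at the origin, with directions $V_k$ and $\mathcal N_d(t)$ deviations: on $\{\mathcal N_d(t)=n\}$, $$Z_d^{2,j}(t)=c\sum_{k=1}^{n}\tau_k(t)V_k+c\Big(t-\sum_{k=1}^n\tau_k(t)\Big)V_{n+1},$$ and let $R_d^{2,j}(t)=\|Z_d^{2,j}(t)\|$ be its Euclidean distance from the origin. Then for all real $p\ge1$ and all $t>0$ the random variable $R_d^{2,j}(t)^p$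 is integrable and $$\mathbf E\big[R_d^{2,j}(t)^p\big]=\frac{(ct)^p}{E_{\frac d2-1,\frac d2}(\lambda t)}\left\{\frac{\Gamma(\frac{p+d}2)}{\Gamma(\frac d2)}\,\lambda t\,E_{\frac d2-1,\,d+\frac p2-1}(\lambda t)+\frac1{\Gamma(\frac d2)}\right\}.$$ -/

import Mathlib

open MeasureTheory ProbabilityTheory

noncomputable section

/-- The generalized Mittag-Leffler function `E_{α,β}(x) = ∑_{k ≥ 0} x ^ k / Γ(α k + β)`. -/
def mittagLefflerE (α β x : ℝ) : ℝ :=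
  ∑' k : ℕ, x ^ k / Real.Gamma (α * k + β)

/-- The open simplex `{τ ∈ ℝⁿ : 0 < τ_k < t - ∑_{i < k} τ_i for all k}`. -/
def timeSimplex (n : ℕ) (t : ℝ) : Set (Fin n → ℝ) :=
  {τ | ∀ k, 0 < τ k ∧ τ k < t - ∑ i ∈ Finset.Iio k, τ i}

/-- The normalizing constant `C(a, b, t)` of the rescaled generalized Dirichlet density. -/
def genDirichletConst {n : ℕ} (a b : Fin n → ℝ) (t : ℝ) : ℝ :=
  1 / t ^ (∑ k, (a k + b k - 1)) *
    ∏ k, Real.Gamma (1 + ∑ i ∈ Finset.Ici k, (a i + b i - 1)) /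
      (Real.Gamma (a k) * Real.Gamma (b k + ∑ i ∈ Finset.Ioi k, (a i + b i - 1)))

/-- The rescaled generalized Dirichlet density on `timeSimplex n t`. -/
def genDirichletPDF {n : ℕ} (a b : Fin n → ℝ) (t : ℝ) (τ : Fin n → ℝ) : ℝ :=
  genDirichletConst a b t *
    ∏ k, (τ k ^ (a k - 1) * (t - ∑ i ∈ Finset.Iic k, τ i) ^ (b k - 1))

/-- The rescaled generalized Dirichlet distribution `GD(a; b)` on the simplex of size `t`. -/
def genDirichlet {n : ℕ} (a b : Fin n → ℝ) (t : ℝ) : Measure (Fin n → ℝ) :=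
  (volume.restrict (timeSimplex n t)).withDensity
    fun τ => ENNReal.ofReal (genDirichletPDF a b t τ)

/-- The parameters `a_1 = ⋯ = a_n = d/2 - 1` of the walk `Z_d^{2,j}` with `n` deviations. -/
def switchA (d n : ℕ) : Fin n → ℝ := fun _ => (d : ℝ) / 2 - 1

/-- The parameters `b_1, …, b_n` of the walk `Z_d^{2,j}` with `n` deviations (the entry of
one-based number `k` is the value at `k - 1 : Fin n`): `b_n = d/2 - 1`, and for `k < n`,
`b_k = 2` if `k = j` and `b_k = 1` otherwise. In particular
`b = (1, …, 1, d/2 - 1)` as soon as `n ≤ j`. -/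
def switchB (d j n : ℕ) : Fin n → ℝ := fun k =>
  if (k : ℕ) + 1 = n then (d : ℝ) / 2 - 1 else if (k : ℕ) + 1 = j then 2 else 1

/-- The uniform distribution on the unit sphere of `ℝ^d` (the normalized surface measure). -/
def uniformSphere (d : ℕ) : Measure (Metric.sphere (0 : EuclideanSpace ℝ (Fin d)) 1) :=
  ((volume : Measure (EuclideanSpace ℝ (Fin d))).toSphere Set.univ)⁻¹ •
    (volume : Measure (EuclideanSpace ℝ (Fin d))).toSphere

/-- Position at time `t` of a walk of speed `c` started at the origin with `n` deviations before
time `t`: its first `n` steps last `τ 0, …, τ (n - 1)`, the last one takes the remaining time,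
and the directions of the `n + 1` steps are `v 0, …, v n`. -/
def walkPosition {d : ℕ} (c t : ℝ) (n : ℕ) (τ : ℕ → ℝ)
    (v : ℕ → Metric.sphere (0 : EuclideanSpace ℝ (Fin d)) 1) : EuclideanSpace ℝ (Fin d) :=
  c • (∑ k ∈ Finset.range n, τ k • (v k : EuclideanSpace ℝ (Fin d)) +
    (t - ∑ k ∈ Finset.range n, τ k) • (v n : EuclideanSpace ℝ (Fin d)))

/-- The random data of the walk `Z_d^{2,j}` paced by the fractional Poisson process of rate `lam`:
`N t` is the number of deviations up to time `t`, `T t k` the length of the step number `k + 1`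
of the motion on `[0, t]`, for `k < N t`, and `V k` the direction of the step number `k + 1`. -/
structure IsSwitchWalk {Ω : Type*} [MeasurableSpace Ω] (μ : Measure Ω) (d j : ℕ) (lam : ℝ)
    (N : ℝ → Ω → ℕ) (T : ℝ → ℕ → Ω → ℝ)
    (V : ℕ → Ω → Metric.sphere (0 : EuclideanSpace ℝ (Fin d)) 1) : Prop where
  measurable_N : ∀ t, 0 < t → Measurable (N t)
  measurable_T : ∀ t, 0 < t → ∀ k, Measurable (T t k)
  measurable_V : ∀ k, Measurable (V k)
  /-- The directions are uniformly distributed on the unit sphere and independent. -/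
  law_V : ∀ k, μ.map (V k) = uniformSphere d
  indep_V : iIndepFun V μ
  /-- The directions are independent of the number of deviations and of the step lengths. -/
  indep : ∀ t, 0 < t →
    IndepFun (fun ω k => V k ω) (fun ω => (N t ω, fun k => T t k ω)) μ
  /-- The number of deviations has the fractional Poisson law. -/
  law_N : ∀ t, 0 < t → ∀ n : ℕ, μ.real (N t ⁻¹' {n}) =
    1 / mittagLefflerE ((d : ℝ) / 2 - 1) ((d : ℝ) / 2) (lam * t) *
      ((lam * t) ^ n / Real.Gamma (n * ((d : ℝ) / 2 - 1) + (d : ℝ) / 2))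
  /-- Given `N t = n ≥ 1`, the first `n` step lengths have the law `GD(a; b)`. -/
  law_T : ∀ t, 0 < t → ∀ n : ℕ, 1 ≤ n →
    (μ[|N t ⁻¹' {n}]).map (fun ω (k : Fin n) => T t k ω) =
      genDirichlet (switchA d n) (switchB d j n) t

/-- The distance process `R_d^{2,j}(t) = ‖Z_d^{2,j}(t)‖`. -/
def distanceProcess {Ω : Type*} {d : ℕ} (c : ℝ) (N : ℝ → Ω → ℕ) (T : ℝ → ℕ → Ω → ℝ)
    (V : ℕ → Ω → Metric.sphere (0 : EuclideanSpace ℝ (Fin d)) 1) (t : ℝ) (ω : Ω) : ℝ :=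
  ‖walkPosition c t (N t ω) (fun k => T t k ω) (fun k => V k ω)‖

end

/-! Write h = d/2 - 1. Given n ≥ 1 deviations, the ratio (R / (c t))² has the Beta law with
parameters h + 1 and n h, whatever j is; for n = 0 it equals 1. Averaging its moment of order p/2
against the fractional Poisson weights gives the formula: the factor Γ((n + 1) h + 1) of the moment
cancels the one in the weight, and a Mittag-Leffler series remains.

The Beta law is found from its integer moments. The projection of a uniform direction on a line has
m-th moment m! Γ(d/2) `besselCoeff h m`. By independence and the binomial formula, for frozen step
lengths the m-th moment of a projection of the walk is, up to explicit factors, a Cauchy product of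
Bessel coefficients (`integral_sum_mul_pow_eq_stepProductCoeff`). Integrating out the step lengths
one at a time is a succession of Beta integrals, each leaving a discrete convolution which a
Rothe–Hagen identity collapses, so that a single coefficient of index (n + 1) h survives
(`exists_lintegral_switchWeight_mul_stepProductCoeff`). The parameters b only have to make a certain
shift δ equal to 0 or 1 at each stage; these are the two cases of the convolution.

Averaging over the line of projection yields the even moments of the distance
(`setIntegral_norm_pow`), and Weierstrass approximation passes from them to real powers
(`integral_eq_of_moments_eq`). The Dirichlet normalizing constant is never evaluated: total mass
one, read at m = 0, determines it. -/

/-! ### Rothe–Hagen identities with step 2 -/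

/-- The binomial coefficient `binom (y + 2 l) l` for real `y`. -/
noncomputable def skewChoose (l : ℕ) (y : ℝ) : ℝ := Ring.choose (y + 2 * l) l

/-- The coefficient `y / (y + 2 l) * binom (y + 2 l) l` for real `y`. -/
noncomputable def rotheCoeff : ℕ → ℝ → ℝ
  | 0, _ => 1
  | k + 1, x => skewChoose (k + 1) x - 2 * skewChoose k (x + 1)

lemma skewChoose_zero (y : ℝ) : skewChoose 0 y = 1 := by simp [skewChoose]

/-- Pascal's rule: lowering l by one lowers y + 2 l by two, which the argument y + 2 compensates. -/
lemma skewChoose_succ_add_one (l : ℕ) (y : ℝ) :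
    skewChoose (l + 1) (y + 1) = skewChoose (l + 1) y + skewChoose l (y + 2) := by
  have h := Ring.choose_succ_succ (y + 2 * (l + 1)) l
  unfold skewChoose
  push_cast
  rw [show y + 1 + 2 * ((l : ℝ) + 1) = y + 2 * (l + 1) + 1 by ring, h,
    show y + 2 + 2 * (l : ℝ) = y + 2 * (l + 1) by ring]
  ring

lemma rotheCoeff_succ_add_one (k : ℕ) (x : ℝ) :
    rotheCoeff (k + 1) (x + 1) = rotheCoeff (k + 1) x + rotheCoeff k (x + 2) := by
  cases k with
  | zero => simp [rotheCoeff, skewChoose]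
  | succ k =>
    simp only [rotheCoeff]
    rw [skewChoose_succ_add_one (k + 1) x, skewChoose_succ_add_one k (x + 1),
      show x + 1 + 2 = x + 2 + 1 by ring]
    ring

lemma skewChoose_eq_descPochhammer (l : ℕ) (y : ℝ) :
    skewChoose l y = (l.factorial : ℝ)⁻¹ * (descPochhammer ℝ l).eval (y + 2 * l) := by
  rw [skewChoose, Ring.choose_eq_smul, smul_eq_mul, ← descPochhammer_map (Int.castRingHom ℝ),
    Polynomial.eval_map, ← Polynomial.eval₂_smulOneHom_eq_smeval]
  congr 2
  exact Subsingleton.elim _ _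

lemma exists_polynomial_skewChoose (l : ℕ) :
    ∃ P : Polynomial ℝ, ∀ y, skewChoose l y = P.eval y :=
  ⟨.C (l.factorial : ℝ)⁻¹ * (descPochhammer ℝ l).comp (.X + .C (2 * l : ℝ)), fun y => by
    simp [skewChoose_eq_descPochhammer]⟩

/-- The definition as a difference avoids dividing by y + 2 l, so it is polynomial in y. This
permits proving identities at natural arguments only, 0 included. -/
lemma exists_polynomial_rotheCoeff (k : ℕ) :
    ∃ P : Polynomial ℝ, ∀ y, rotheCoeff k y = P.eval y := by
  cases k with
  | zero => exact ⟨1, fun y => by simp [rotheCoeff]⟩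
  | succ k =>
    obtain ⟨P, hP⟩ := exists_polynomial_skewChoose (k + 1)
    obtain ⟨Q, hQ⟩ := exists_polynomial_skewChoose k
    exact ⟨P - 2 * Q.comp (.X + 1), fun y => by simp [rotheCoeff, hP, hQ]⟩

lemma descPochhammer_eval_mul_Gamma (n : ℕ) (r : ℝ) (hr : (n : ℝ) < r + 1) :
    (descPochhammer ℝ n).eval r * Real.Gamma (r - n + 1) = Real.Gamma (r + 1) := by
  induction n with
  | zero => simp
  | succ n ih =>
    push_cast at hr ⊢
    rw [descPochhammer_succ_eval, ← ih (by linarith), Real.Gamma_add_one (s := r - n) (by linarith),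
      show r - ((n : ℝ) + 1) + 1 = r - n by ring]
    ring

lemma skewChoose_eq_Gamma (l : ℕ) {y : ℝ} (hy : 0 < y) :
    skewChoose l y = Real.Gamma (y + 2 * l + 1) / (l.factorial * Real.Gamma (y + l + 1)) := by
  have h := descPochhammer_eval_mul_Gamma l (y + 2 * l)
    (by have : (0 : ℝ) ≤ l := l.cast_nonneg
        linarith)
  rw [show y + 2 * (l : ℝ) - l + 1 = y + l + 1 by ring] at h
  rw [skewChoose_eq_descPochhammer, ← h]
  have : 0 < Real.Gamma (y + l + 1) := Real.Gamma_pos_of_pos (by positivity)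
  have := l.factorial_pos
  field_simp

lemma rotheCoeff_eq_Gamma (k : ℕ) {x : ℝ} (hx : 0 < x) :
    rotheCoeff k x = x * (Real.Gamma (x + 2 * k) / (k.factorial * Real.Gamma (x + k + 1))) := by
  cases k with
  | zero =>
    have := Real.Gamma_pos_of_pos hx
    simp only [rotheCoeff, Nat.cast_zero, mul_zero, add_zero, Nat.factorial_zero, Nat.cast_one,
      one_mul, Real.Gamma_add_one hx.ne']
    field_simp
  | succ k =>
    rw [rotheCoeff, skewChoose_eq_Gamma _ hx, skewChoose_eq_Gamma _ (by linarith : 0 < x + 1)]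
    have hk : (0 : ℝ) ≤ k := k.cast_nonneg
    push_cast [Nat.factorial_succ]
    rw [show x + 2 * ((k : ℝ) + 1) + 1 = (x + 2 * (k + 1)) + 1 by ring,
      Real.Gamma_add_one (s := x + 2 * ((k : ℝ) + 1)) (by positivity),
      show x + 1 + 2 * (k : ℝ) + 1 = x + 2 * (k + 1) by ring,
      show x + 1 + (k : ℝ) + 1 = x + (k + 1) + 1 by ring]
    have : 0 < Real.Gamma (x + (k + 1) + 1) := Real.Gamma_pos_of_pos (by positivity)
    have := k.factorial_pos
    field_simp
    ring

/-- The Rothe–Hagen identity with step `2`. -/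
theorem sum_rotheCoeff_mul_skewChoose (n : ℕ) (x y : ℝ) :
    ∑ kl ∈ Finset.HasAntidiagonal.antidiagonal n, rotheCoeff kl.1 x * skewChoose kl.2 y =
      skewChoose n (x + y) := by
  induction n generalizing x with
  | zero => simp [rotheCoeff, skewChoose_zero]
  | succ n ih =>
    choose P hP using exists_polynomial_rotheCoeff
    obtain ⟨Q, hQ⟩ := exists_polynomial_skewChoose (n + 1)
    let L : Polynomial ℝ := ∑ kl ∈ Finset.HasAntidiagonal.antidiagonal (n + 1),
      P kl.1 * .C (skewChoose kl.2 y)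
    have hL (x : ℝ) : L.eval x =
        ∑ kl ∈ Finset.HasAntidiagonal.antidiagonal (n + 1),
          rotheCoeff kl.1 x * skewChoose kl.2 y := by
      simp [L, Polynomial.eval_finsetSum, hP]
    -- Both sides are polynomials in x, so agreement at every natural number m suffices.
    have key : L = Q.comp (.X + .C y) := by
      refine Polynomial.eq_of_infinite_eval_eq _ _
        ((Set.infinite_range_of_injective (Nat.cast_injective (R := ℝ))).mono ?_)
      rintro _ ⟨m, rfl⟩
      simp only [Set.mem_ofPred_eq, Polynomial.eval_comp, Polynomial.eval_add, Polynomial.eval_X,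
        Polynomial.eval_C, ← hQ, hL]
      induction m with
      | zero =>
        -- At x = 0 every Rothe coefficient of positive order vanishes, so only the pair (0, n + 1)
        -- contributes.
        rw [Finset.Nat.sum_antidiagonal_succ, Finset.sum_eq_zero]
        · simp [rotheCoeff]
        · rintro ⟨k, l⟩ -
          have : rotheCoeff (k + 1) 0 = 0 := by
            have h1 : rotheCoeff (k + 1) 0 =
                (Nat.choose (2 * (k + 1)) (k + 1) : ℝ) - 2 * Nat.choose (2 * k + 1) k := by
              simp only [rotheCoeff, skewChoose]
              rw [← Ring.choose_natCast, ← Ring.choose_natCast]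
              push_cast
              ring_nf
            have h2 : Nat.choose (2 * (k + 1)) (k + 1) = 2 * Nat.choose (2 * k + 1) k := by
              rw [show 2 * (k + 1) = 2 * k + 1 + 1 by ring, Nat.choose_succ_succ',
                Nat.choose_symm_half]
              ring
            rw [h1, h2]
            push_cast
            ring
          simp [this]
      | succ m ihm =>
        push_cast
        rw [Finset.Nat.sum_antidiagonal_succ] at ihm ⊢
        -- The Pascal-type recurrence lowers the order while moving x by 2; hence the induction
        -- hypothesis for all x.
        have := ih ((m : ℝ) + 2)
        simp only [rotheCoeff_succ_add_one, add_mul, Finset.sum_add_distrib, this]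
        rw [← add_assoc]
        have h0 : rotheCoeff 0 ((m : ℝ) + 1) = rotheCoeff 0 (m : ℝ) := rfl
        rw [h0, ihm, show (m : ℝ) + 1 + y = m + y + 1 by ring, skewChoose_succ_add_one,
          show (m : ℝ) + 2 + y = m + y + 2 by ring]
    rw [← hL, key]
    simp [hQ]

/-- The symmetric form of the Rothe–Hagen identity with step `2`. -/
theorem sum_rotheCoeff_mul_rotheCoeff (n : ℕ) (x y : ℝ) :
    ∑ kl ∈ Finset.HasAntidiagonal.antidiagonal n, rotheCoeff kl.1 x * rotheCoeff kl.2 y =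
      rotheCoeff n (x + y) := by
  cases n with
  | zero => simp [rotheCoeff]
  | succ n =>
    have h1 := sum_rotheCoeff_mul_skewChoose (n + 1) x y
    -- The second Rothe factor is a difference of two skew binomials, so the sum is the previous
    -- identity at (n + 1, y) minus twice the one at (n, y + 1).
    have h2 := sum_rotheCoeff_mul_skewChoose n x (y + 1)
    rw [Finset.Nat.sum_antidiagonal_succ'] at h1 ⊢
    simp only [rotheCoeff]
    simp only [mul_sub, Finset.sum_sub_distrib]
    rw [← add_assoc] at h2
    rw [← h1, ← h2, Finset.mul_sum]
    simp only [skewChoose_zero, rotheCoeff]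
    have (a b : ℝ) : a * (2 * b) = 2 * (a * b) := by ring
    simp only [this]
    ring

/-- The total 2 q being even, k and l have the same parity, so vanishing at odd k removes every odd
pair. -/
lemma sum_antidiagonal_two_mul {f : ℕ → ℕ → ℝ} (q : ℕ) (hf : ∀ k l, ¬ Even k → f k l = 0) :
    ∑ kl ∈ Finset.HasAntidiagonal.antidiagonal (2 * q), f kl.1 kl.2 =
      ∑ kl ∈ Finset.HasAntidiagonal.antidiagonal q, f (2 * kl.1) (2 * kl.2) := by
  symm
  refine Finset.sum_of_injOn (fun kl => (2 * kl.1, 2 * kl.2)) ?_ ?_ ?_ (fun _ _ => rfl)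
  · rintro ⟨a, b⟩ _ ⟨c, d⟩ _ h
    simp at h ⊢
    omega
  · rintro ⟨a, b⟩ h
    simp at h ⊢
    omega
  · rintro ⟨a, b⟩ h h'
    refine hf _ _ fun hev => h' ?_
    obtain ⟨k, hk⟩ := hev
    simp only [Finset.HasAntidiagonal.mem_antidiagonal] at h
    exact ⟨(k, q - k), by simp; omega, by simp; omega⟩

/-! ### Convolution of Bessel coefficients -/

/-- The coefficient of `x ^ m` in `∑ q, (x / 2) ^ (2 q) / (q! Γ(ν + q + 1))`. -/
noncomputable def besselCoeff (ν : ℝ) (m : ℕ) : ℝ :=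
  if Even m then 1 / (2 ^ m * ((m / 2).factorial * Real.Gamma (ν + (m / 2 : ℕ) + 1))) else 0

lemma besselCoeff_two_mul (ν : ℝ) (q : ℕ) :
    besselCoeff ν (2 * q) = 1 / (2 ^ (2 * q) * (q.factorial * Real.Gamma (ν + q + 1))) := by
  simp [besselCoeff]

lemma besselCoeff_of_not_even (ν : ℝ) {m : ℕ} (hm : ¬ Even m) : besselCoeff ν m = 0 := by
  simp [besselCoeff, hm]

lemma besselCoeff_nonneg {ν : ℝ} (hν : 0 < ν) (m : ℕ) : 0 ≤ besselCoeff ν m := by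
  unfold besselCoeff
  have : 0 < Real.Gamma (ν + (m / 2 : ℕ) + 1) := Real.Gamma_pos_of_pos (by positivity)
  split_ifs <;> positivity

/-- The coefficientwise form of the convolution identities for Bessel functions. -/
theorem exists_sum_besselCoeff_mul {x y δ : ℝ} (hx : 0 < x) (hy : 0 < y) (hδ : δ = 0 ∨ δ = 1) :
    ∃ κ : ℝ, 0 ≤ κ ∧ ∀ m : ℕ, ∑ kl ∈ Finset.HasAntidiagonal.antidiagonal m,
      (besselCoeff x kl.1 * Real.Gamma (x + kl.1)) *
        (besselCoeff y kl.2 * Real.Gamma (y + δ + kl.2)) =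
      κ * (besselCoeff (x + y) m * Real.Gamma (x + y + δ + m)) := by
  have hodd (κ : ℝ) (m : ℕ) (hm : ¬ Even m) : ∑ kl ∈ Finset.HasAntidiagonal.antidiagonal m,
      (besselCoeff x kl.1 * Real.Gamma (x + kl.1)) *
        (besselCoeff y kl.2 * Real.Gamma (y + δ + kl.2)) =
      κ * (besselCoeff (x + y) m * Real.Gamma (x + y + δ + m)) := by
    rw [besselCoeff_of_not_even _ hm, Finset.sum_eq_zero]
    · simp
    · rintro ⟨k, l⟩ h
      rw [Finset.HasAntidiagonal.mem_antidiagonal] at h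
      by_cases hk : Even k
      · have : ¬ Even l := fun hl => hm (h ▸ hk.add hl)
        simp [besselCoeff_of_not_even _ this]
      · simp [besselCoeff_of_not_even _ hk]
  -- The Gamma weights turn Bessel coefficients into Rothe coefficients, or into skew binomials when
  -- the argument is shifted by 1.
  have ha (k : ℕ) {x : ℝ} (hx : 0 < x) :
      besselCoeff x (2 * k) * Real.Gamma (x + (2 * k : ℕ)) = rotheCoeff k x / (2 ^ (2 * k) * x) := by
    rw [besselCoeff_two_mul, rotheCoeff_eq_Gamma _ hx]
    push_cast
    field_simp
  have hb (k : ℕ) {x : ℝ} (hx : 0 < x) :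
      besselCoeff x (2 * k) * Real.Gamma (x + 1 + (2 * k : ℕ)) = skewChoose k x / (2 ^ (2 * k)) := by
    rw [besselCoeff_two_mul, skewChoose_eq_Gamma _ hx]
    push_cast
    rw [show x + 1 + 2 * (k : ℝ) = x + 2 * k + 1 by ring]
    field_simp
  rcases hδ with rfl | rfl
  -- Each Rothe factor carries the reciprocal of its argument: 1/x and 1/y on the left, 1/(x + y) on
  -- the right. For δ = 1 only the first factor does, whence 1/x.
  · refine ⟨(x + y) / (x * y), by positivity, fun m => ?_⟩
    by_cases hm : Even m
    · obtain ⟨q, rfl⟩ := even_iff_exists_two_mul.1 hm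
      rw [sum_antidiagonal_two_mul (f := fun k l => (besselCoeff x k * Real.Gamma (x + k)) *
        (besselCoeff y l * Real.Gamma (y + 0 + l))) q
        (fun k l hk => by simp [besselCoeff_of_not_even _ hk])]
      simp only [add_zero, ha _ hx, ha _ hy, ha _ (add_pos hx hy)]
      rw [← sum_rotheCoeff_mul_rotheCoeff, Finset.sum_div, Finset.mul_sum]
      refine Finset.sum_congr rfl fun kl hkl => ?_
      rw [← Finset.HasAntidiagonal.mem_antidiagonal.1 hkl, mul_add 2, pow_add]
      field_simp
    · exact hodd _ m hm
  · refine ⟨1 / x, by positivity, fun m => ?_⟩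
    by_cases hm : Even m
    · obtain ⟨q, rfl⟩ := even_iff_exists_two_mul.1 hm
      rw [sum_antidiagonal_two_mul (f := fun k l => (besselCoeff x k * Real.Gamma (x + k)) *
        (besselCoeff y l * Real.Gamma (y + 1 + l))) q
        (fun k l hk => by simp [besselCoeff_of_not_even _ hk])]
      simp only [ha _ hx, hb _ hy, hb _ (add_pos hx hy)]
      rw [← sum_rotheCoeff_mul_skewChoose, Finset.sum_div, Finset.mul_sum]
      refine Finset.sum_congr rfl fun kl hkl => ?_
      rw [← Finset.HasAntidiagonal.mem_antidiagonal.1 hkl, mul_add 2, pow_add]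
      field_simp
    · exact hodd _ m hm

/-! ### Integration over the time simplex -/

lemma lintegral_Ioo_rpow_mul_rpow {a b t : ℝ} (ha : 0 < a) (hb : 0 < b) (ht : 0 < t) :
    ∫⁻ x in Set.Ioo 0 t, ENNReal.ofReal (x ^ (a - 1) * (t - x) ^ (b - 1)) =
      ENNReal.ofReal (beta a b * t ^ (a + b - 1)) := by
  have hB := beta_pos ha hb
  have himg : (fun u : ℝ => t * u) '' Set.Ioo 0 1 = Set.Ioo 0 t := by
    simp [Set.image_mul_left_Ioo ht]
  rw [← himg, lintegral_image_eq_lintegral_abs_deriv_mul (f' := fun _ => t) measurableSet_Ioo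
    (fun x _ => by simpa using ((hasDerivAt_id x).const_mul t).hasDerivWithinAt)
    (fun x _ y _ h => mul_left_cancel₀ ht.ne' h)]
  rw [← mul_one (ENNReal.ofReal (beta a b * t ^ (a + b - 1))),
    ← lintegral_betaPDF_eq_one ha hb, lintegral_betaPDF, ← lintegral_const_mul _ (by fun_prop)]
  refine setLIntegral_congr_fun measurableSet_Ioo fun x hx => ?_
  have hx1 : 0 < 1 - x := sub_pos.2 hx.2
  rw [← ENNReal.ofReal_mul (abs_nonneg _), ← ENNReal.ofReal_mul (by positivity), abs_of_pos ht]
  congr 1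
  rw [show t - t * x = t * (1 - x) by ring, Real.mul_rpow ht.le hx.1.le,
    Real.mul_rpow ht.le hx1.le, show a + b - 1 = 1 + (a - 1) + (b - 1) by ring,
    Real.rpow_add ht, Real.rpow_add ht, Real.rpow_one]
  field_simp

lemma Fin.sum_Iio_succ_eq {n : ℕ} (k : Fin n) (f : Fin (n + 1) → ℝ) :
    ∑ i ∈ Finset.Iio k.succ, f i = f 0 + ∑ i ∈ Finset.Iio k, f i.succ := by
  have : Finset.Iio k.succ = Finset.cons 0 ((Finset.Iio k).map (Fin.succEmb n)) (by simp) := by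
    ext i
    induction i using Fin.cases <;> simp
  rw [this, Finset.sum_cons, Finset.sum_map]
  rfl

lemma Fin.sum_Iic_succ_eq {n : ℕ} (k : Fin n) (f : Fin (n + 1) → ℝ) :
    ∑ i ∈ Finset.Iic k.succ, f i = f 0 + ∑ i ∈ Finset.Iic k, f i.succ := by
  have : Finset.Iic k.succ = Finset.cons 0 ((Finset.Iic k).map (Fin.succEmb n)) (by simp) := by
    ext i
    induction i using Fin.cases <;> simp
  rw [this, Finset.sum_cons, Finset.sum_map]
  rfl

/-- Self-similarity: after a first step x, the other steps range over the simplex of the remaining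
time t - x. The integration by induction on n rests on it. -/
lemma cons_mem_timeSimplex {n : ℕ} {t x : ℝ} {τ : Fin n → ℝ} :
    (Fin.cons x τ : Fin (n + 1) → ℝ) ∈ timeSimplex (n + 1) t ↔
      x ∈ Set.Ioo 0 t ∧ τ ∈ timeSimplex n (t - x) := by
  have h0 : Finset.Iio (0 : Fin (n + 1)) = ∅ := by ext i; simp
  simp only [timeSimplex, Set.mem_ofPred_eq, Fin.forall_fin_succ, Fin.sum_Iio_succ_eq, h0]
  simp [sub_sub]

lemma measurableSet_timeSimplex (n : ℕ) (t : ℝ) : MeasurableSet (timeSimplex n t) := by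
  have : timeSimplex n t =
      ⋂ k, {τ | 0 < τ k} ∩ {τ | τ k < t - ∑ i ∈ Finset.Iio k, τ i} := by
    ext τ
    simp [timeSimplex]
  rw [this]
  exact .iInter fun k => (measurableSet_lt (by fun_prop) (by fun_prop)).inter
    (measurableSet_lt (by fun_prop) (by fun_prop))

lemma lintegral_timeSimplex_succ {n : ℕ} {t : ℝ} {g : (Fin (n + 1) → ℝ) → ENNReal}
    (hg : Measurable g) :
    ∫⁻ τ in timeSimplex (n + 1) t, g τ =
      ∫⁻ x in Set.Ioo 0 t, ∫⁻ τ in timeSimplex n (t - x), g (Fin.cons x τ) := by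
  rw [← lintegral_indicator (measurableSet_timeSimplex _ _),
    ← (volume_preserving_piFinSuccAbove (fun _ : Fin (n + 1) => ℝ) 0).symm.lintegral_comp
      (hg.indicator (measurableSet_timeSimplex _ _)), Measure.volume_eq_prod, lintegral_prod]
  · rw [← lintegral_indicator measurableSet_Ioo]
    refine lintegral_congr fun x => ?_
    simp only [MeasurableEquiv.piFinSuccAbove_symm_apply, Fin.insertNthEquiv, Equiv.coe_fn_mk,
      Fin.insertNth_zero']
    by_cases hx : x ∈ Set.Ioo 0 t
    · rw [Set.indicator_of_mem hx, ← lintegral_indicator (measurableSet_timeSimplex _ _)]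
      refine lintegral_congr fun τ => ?_
      by_cases hτ : τ ∈ timeSimplex n (t - x)
      · rw [Set.indicator_of_mem hτ, Set.indicator_of_mem (cons_mem_timeSimplex.2 ⟨hx, hτ⟩)]
      · rw [Set.indicator_of_notMem hτ,
          Set.indicator_of_notMem fun h => hτ (cons_mem_timeSimplex.1 h).2]
    · rw [Set.indicator_of_notMem hx]
      simp [Set.indicator_of_notMem, cons_mem_timeSimplex, hx]
  · exact ((hg.indicator (measurableSet_timeSimplex _ _)).comp
      (MeasurableEquiv.measurable _)).aemeasurable

/-- The unnormalized density of the generalized Dirichlet distribution with `a = (h, …, h)`. -/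
noncomputable def switchWeight {n : ℕ} (h : ℝ) (b : Fin n → ℝ) (t : ℝ) (τ : Fin n → ℝ) : ℝ :=
  ∏ k, (τ k ^ (h - 1) * (t - ∑ i ∈ Finset.Iic k, τ i) ^ (b k - 1))

/-- The coefficients of the product of the Bessel series evaluated at the `n + 1` step lengths
`τ 0, …, τ (n - 1), t - ∑ i, τ i`. -/
noncomputable def stepProductCoeff (ν : ℝ) : (n m : ℕ) → ℝ → (Fin n → ℝ) → ℝ
  | 0, m, t, _ => besselCoeff ν m * t ^ m
  | n + 1, m, t, τ => ∑ kl ∈ Finset.HasAntidiagonal.antidiagonal m,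
      besselCoeff ν kl.1 * τ 0 ^ kl.1 * stepProductCoeff ν n kl.2 (t - τ 0) (Fin.tail τ)

lemma switchWeight_cons {n : ℕ} (h : ℝ) (b : Fin (n + 1) → ℝ) (t x : ℝ) (τ : Fin n → ℝ) :
    switchWeight h b t (Fin.cons x τ) =
      x ^ (h - 1) * (t - x) ^ (b 0 - 1) * switchWeight h (Fin.tail b) (t - x) τ := by
  have h0 : Finset.Iic (0 : Fin (n + 1)) = {0} := by ext i; simp
  simp only [switchWeight, Fin.prod_univ_succ, Fin.sum_Iic_succ_eq, h0]
  simp [sub_sub, Fin.tail]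

lemma stepProductCoeff_cons (ν : ℝ) (n m : ℕ) (t x : ℝ) (τ : Fin n → ℝ) :
    stepProductCoeff ν (n + 1) m t (Fin.cons x τ) =
      ∑ kl ∈ Finset.HasAntidiagonal.antidiagonal m,
        besselCoeff ν kl.1 * x ^ kl.1 * stepProductCoeff ν n kl.2 (t - x) τ := by
  simp [stepProductCoeff]

lemma switchWeight_nonneg {n : ℕ} (h : ℝ) (b : Fin n → ℝ) {t : ℝ} {τ : Fin n → ℝ}
    (hτ : τ ∈ timeSimplex n t) : 0 ≤ switchWeight h b t τ := by
  refine Finset.prod_nonneg fun k _ => mul_nonneg (Real.rpow_nonneg (hτ k).1.le _)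
    (Real.rpow_nonneg ?_ _)
  have h1 := (hτ k).2
  have h2 : ∑ i ∈ Finset.Iic k, τ i = τ k + ∑ i ∈ Finset.Iio k, τ i := by
    rw [← Finset.Iio_insert, Finset.sum_insert (by simp)]
  linarith

lemma stepProductCoeff_nonneg {ν : ℝ} (hν : 0 < ν) (n m : ℕ) {t : ℝ} (ht : 0 < t)
    {τ : Fin n → ℝ} (hτ : τ ∈ timeSimplex n t) : 0 ≤ stepProductCoeff ν n m t τ := by
  induction n generalizing m t with
  | zero => exact mul_nonneg (besselCoeff_nonneg hν m) (pow_nonneg ht.le _)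
  | succ n ih =>
    obtain ⟨h1, h2⟩ := cons_mem_timeSimplex.1 ((Fin.cons_self_tail τ).symm ▸ hτ)
    exact Finset.sum_nonneg fun kl _ => mul_nonneg (mul_nonneg (besselCoeff_nonneg hν _)
      (pow_nonneg h1.1.le _)) (ih _ (sub_pos.2 h1.2) h2)

@[fun_prop]
lemma measurable_switchWeight {n : ℕ} (h : ℝ) (b : Fin n → ℝ) :
    Measurable fun p : ℝ × (Fin n → ℝ) => switchWeight h b p.1 p.2 := by
  unfold switchWeight
  fun_prop

@[fun_prop]
lemma measurable_stepProductCoeff (ν : ℝ) (n m : ℕ) :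
    Measurable fun p : ℝ × (Fin n → ℝ) => stepProductCoeff ν n m p.1 p.2 := by
  induction n generalizing m with
  | zero => unfold stepProductCoeff; fun_prop
  | succ n ih =>
    unfold stepProductCoeff
    refine Finset.measurable_fun_sum _ fun kl _ => Measurable.mul (by fun_prop) ?_
    exact (ih kl.2).comp (f := fun p : ℝ × (Fin (n + 1) → ℝ) => (p.1 - p.2 0, Fin.tail p.2))
      (by unfold Fin.tail; fun_prop)

/-- Under the weight of a generalized Dirichlet distribution whose partial parameter sums are
admissible, a product of Bessel series integrates to a single Bessel series. -/
theorem exists_lintegral_switchWeight_mul_stepProductCoeff {h : ℝ} (hh : 0 < h) (n : ℕ)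
    (b : Fin n → ℝ)
    (hb : ∀ k, 1 - h + ∑ i ∈ Finset.Ici k, (b i - 1) = 0 ∨
      1 - h + ∑ i ∈ Finset.Ici k, (b i - 1) = 1) :
    ∃ κ : ℝ, 0 ≤ κ ∧ ∀ t, 0 < t → ∀ m : ℕ,
      ∫⁻ τ in timeSimplex n t,
        ENNReal.ofReal (switchWeight h b t τ * stepProductCoeff h n m t τ) =
      ENNReal.ofReal (κ * (besselCoeff ((n + 1) * h) m *
        t ^ (n * h + ∑ i, (b i - 1) + m))) := by
  induction n with
  | zero =>
    refine ⟨1, zero_le_one, fun t ht m => ?_⟩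
    have : timeSimplex 0 t = Set.univ := by
      ext τ
      simp [timeSimplex]
    simp [this, switchWeight, stepProductCoeff, Measure.volume_pi_eq_dirac (0 : Fin 0 → ℝ)]
  | succ n ih =>
    -- That κ depends neither on the time nor on the order is essential: it is used at time t - x,
    -- for all orders l ≤ m at once.
    obtain ⟨κ, hκ, hI⟩ := ih (Fin.tail b) fun k => by
      have := hb k.succ
      rwa [Fin.sum_Ici_succ] at this
    have hb0 := hb 0
    have hIci : Finset.Ici (0 : Fin (n + 1)) = Finset.univ := by ext i; simp
    rw [hIci] at hb0
    set δ := 1 - h + ∑ i, (b i - 1) with hδ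
    have hy : 0 < ((n : ℝ) + 1) * h := by positivity
    obtain ⟨κ', hκ', hS⟩ := exists_sum_besselCoeff_mul hh hy hb0
    refine ⟨κ * κ', by positivity, fun t ht m => ?_⟩
    have hδ0 : 0 ≤ δ := by rcases hb0 with h | h <;> simp [h]
    have hm : Measurable fun τ : Fin (n + 1) → ℝ =>
        ENNReal.ofReal (switchWeight h b t τ * stepProductCoeff h (n + 1) m t τ) := by
      have h1 := (measurable_switchWeight h b).comp (measurable_prodMk_left (x := t))
      have h2 := (measurable_stepProductCoeff h (n + 1) m).comp (measurable_prodMk_left (x := t))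
      exact (h1.mul h2).ennreal_ofReal
    rw [lintegral_timeSimplex_succ hm]
    have hsum : ∑ i, (b i - 1) = (b 0 - 1) + ∑ i, (Fin.tail b i - 1) := by
      rw [Fin.sum_univ_succ]; rfl
    set e := n * h + ∑ i, (Fin.tail b i - 1) with he
    -- After the inner integration t - x has exponent b 0 - 1 + e + l, which is (n + 1) h + δ + l -
    -- 1: the index of the inner Bessel coefficient, shifted by δ.
    have heδ : e + b 0 = (n + 1) * h + δ := by rw [hδ, hsum]; ring
    have inner : ∀ x ∈ Set.Ioo 0 t, ∫⁻ τ in timeSimplex n (t - x),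
        ENNReal.ofReal (switchWeight h b t (Fin.cons x τ) *
          stepProductCoeff h (n + 1) m t (Fin.cons x τ)) =
        ∑ kl ∈ Finset.HasAntidiagonal.antidiagonal m,
          ENNReal.ofReal (κ * (besselCoeff h kl.1 * besselCoeff ((n + 1) * h) kl.2)) *
            ENNReal.ofReal (x ^ (h + kl.1 - 1) * (t - x) ^ ((n + 1) * h + δ + kl.2 - 1)) := by
      intro x hx
      have htx : 0 < t - x := sub_pos.2 hx.2
      calc _ = ∫⁻ τ in timeSimplex n (t - x), ∑ kl ∈ Finset.HasAntidiagonal.antidiagonal m,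
            ENNReal.ofReal (x ^ (h - 1) * (t - x) ^ (b 0 - 1) * (besselCoeff h kl.1 * x ^ kl.1)) *
              ENNReal.ofReal (switchWeight h (Fin.tail b) (t - x) τ *
                stepProductCoeff h n kl.2 (t - x) τ) := by
            refine setLIntegral_congr_fun (measurableSet_timeSimplex _ _) fun τ hτ => ?_
            have hw := switchWeight_nonneg h (Fin.tail b) hτ
            have hbes (k : ℕ) := besselCoeff_nonneg hh k
            have hx0 := hx.1
            rw [switchWeight_cons, stepProductCoeff_cons, Finset.mul_sum,
              ENNReal.ofReal_sum_of_nonneg]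
            · refine Finset.sum_congr rfl fun kl _ => ?_
              have := hbes kl.1
              rw [← ENNReal.ofReal_mul (by positivity)]
              congr 1
              ring
            · intro kl _
              have := hbes kl.1
              have := stepProductCoeff_nonneg hh n kl.2 htx hτ
              positivity
        _ = _ := by
            rw [lintegral_finsetSum]
            · refine Finset.sum_congr rfl fun kl _ => ?_
              have h1 := besselCoeff_nonneg hh kl.1
              have h2 := besselCoeff_nonneg hy kl.2
              have hx0 := hx.1
              rw [lintegral_const_mul', hI _ htx, ← ENNReal.ofReal_mul (by positivity),
                ← ENNReal.ofReal_mul (by positivity)]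
              · congr 1
                rw [show h + (kl.1 : ℝ) - 1 = (h - 1) + kl.1 by ring, ← heδ,
                  show e + b 0 + (kl.2 : ℝ) - 1 = (b 0 - 1) + (e + kl.2) by ring,
                  Real.rpow_add hx0 (h - 1), Real.rpow_add htx (b 0 - 1), Real.rpow_natCast]
                ring
              · exact ENNReal.ofReal_ne_top
            · intro kl _
              have h1 := (measurable_switchWeight h (Fin.tail b)).comp
                (measurable_prodMk_left (x := t - x))
              have h2 := (measurable_stepProductCoeff h n kl.2).comp
                (measurable_prodMk_left (x := t - x))
              exact (h1.mul h2).ennreal_ofReal.const_mul _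
    rw [setLIntegral_congr_fun measurableSet_Ioo inner, lintegral_finsetSum _ (by fun_prop)]
    -- The denominator of the Beta integral depends on k and l only through m = k + l, so it leaves
    -- the sum, and the numerators are the weights of the convolution identity.
    have term : ∀ kl ∈ Finset.HasAntidiagonal.antidiagonal m, ∫⁻ x in Set.Ioo 0 t,
          ENNReal.ofReal (κ * (besselCoeff h kl.1 * besselCoeff ((n + 1) * h) kl.2)) *
            ENNReal.ofReal (x ^ (h + kl.1 - 1) * (t - x) ^ ((n + 1) * h + δ + kl.2 - 1)) =
        ENNReal.ofReal (κ * t ^ (h + (n + 1) * h + δ + m - 1) /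
          Real.Gamma (h + (n + 1) * h + δ + m) *
          ((besselCoeff h kl.1 * Real.Gamma (h + kl.1)) * (besselCoeff ((n + 1) * h) kl.2 *
            Real.Gamma ((n + 1) * h + δ + kl.2)))) := by
      intro kl hkl
      have h1 := besselCoeff_nonneg hh kl.1
      have h2 := besselCoeff_nonneg hy kl.2
      have hm : (m : ℝ) = kl.1 + kl.2 := by
        rw [← Finset.HasAntidiagonal.mem_antidiagonal.1 hkl]; push_cast; rfl
      rw [lintegral_const_mul' _ _ ENNReal.ofReal_ne_top, lintegral_Ioo_rpow_mul_rpow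
        (by positivity) (by positivity) ht, ← ENNReal.ofReal_mul (by positivity), beta, hm]
      rw [show h + kl.1 + ((n + 1) * h + δ + kl.2) = h + (n + 1) * h + δ + (kl.1 + kl.2) by ring]
      congr 1
      ring
    rw [Finset.sum_congr rfl term, ← ENNReal.ofReal_sum_of_nonneg, ← Finset.mul_sum, hS]
    · have hG : 0 < Real.Gamma (h + (n + 1) * h + δ + m) := Real.Gamma_pos_of_pos (by positivity)
      congr 1
      rw [show h + (n + 1) * h + δ + m - 1 = ((n + 1 : ℕ) : ℝ) * h + ∑ i, (b i - 1) + m by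
          rw [hδ]; push_cast; ring,
        show ((n + 1 : ℕ) + 1 : ℝ) * h = h + (n + 1) * h by push_cast; ring]
      field_simp
    · intro kl _
      have h1 := besselCoeff_nonneg hh kl.1
      have h2 := besselCoeff_nonneg hy kl.2
      have hG : 0 < Real.Gamma (h + (n + 1) * h + δ + m) := Real.Gamma_pos_of_pos (by positivity)
      have hG1 : 0 < Real.Gamma (h + kl.1) := Real.Gamma_pos_of_pos (by positivity)
      have hG2 : 0 < Real.Gamma ((n + 1) * h + δ + kl.2) := Real.Gamma_pos_of_pos (by positivity)
      positivity

/-! ### Moments of a projected uniform direction -/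

lemma integral_pow_mul_exp_neg_sq (m : ℕ) :
    ∫ x : ℝ, x ^ m * Real.exp (-x ^ 2) =
      if Even m then Real.Gamma (((m : ℝ) + 1) / 2) else 0 := by
  split_ifs with hm
  · have h1 : ∀ x : ℝ, x ^ m * Real.exp (-x ^ 2) =
        (fun y : ℝ => y ^ m * Real.exp (-y ^ 2)) |x| := fun x => by
      simp only [hm.pow_abs, sq_abs]
    rw [integral_congr_ae (.of_forall h1),
      integral_comp_abs (f := fun y : ℝ => y ^ m * Real.exp (-y ^ 2))]
    have h2 := integral_rpow_mul_exp_neg_rpow (p := 2) (q := m) two_pos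
      (by linarith [(Nat.cast_nonneg m : (0 : ℝ) ≤ m)])
    simp only [Real.rpow_natCast, Real.rpow_two] at h2
    rw [h2]
    ring
  · have h1 := integral_neg_eq_self (fun x : ℝ => x ^ m * Real.exp (-x ^ 2)) volume
    simp only [(Nat.not_even_iff_odd.1 hm).neg_pow, even_two.neg_pow, neg_mul, integral_neg] at h1
    linarith

lemma Gamma_nat_add_half_mul (k : ℕ) :
    Real.Gamma ((k : ℝ) + 1 / 2) * (2 ^ (2 * k) * k.factorial) =
      √Real.pi * (2 * k).factorial := by
  induction k with
  | zero => simp [Real.Gamma_one_half_eq, -one_div]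
  | succ k ih =>
    push_cast
    rw [show (k : ℝ) + 1 + 1 / 2 = (k + 1 / 2) + 1 by ring, Real.Gamma_add_one (by positivity),
      show 2 * (k + 1) = 2 * k + 1 + 1 by ring, Nat.factorial_succ, Nat.factorial_succ,
      Nat.factorial_succ, pow_succ, pow_succ]
    push_cast
    linear_combination (2 * (k : ℝ) + 1) * (2 * k + 2) * ih

/-- A reflection moves e to a basis vector; the Gaussian weight then splits over the coordinates,
and each of the d - 1 others contributes √π. -/
lemma integral_inner_pow_mul_exp_neg_norm_sq {d : ℕ} (hd : 0 < d)
    {e : EuclideanSpace ℝ (Fin d)} (he : ‖e‖ = 1) (m : ℕ) :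
    ∫ x : EuclideanSpace ℝ (Fin d), inner ℝ e x ^ m * Real.exp (-‖x‖ ^ 2) =
      (∫ x : ℝ, x ^ m * Real.exp (-x ^ 2)) * √Real.pi ^ (d - 1) := by
  let i₀ : Fin d := ⟨0, hd⟩
  let e₀ : EuclideanSpace ℝ (Fin d) := EuclideanSpace.single i₀ 1
  have he₀ : ‖e₀‖ = ‖e‖ := by simp [e₀, he]
  let L := (ℝ ∙ (e₀ - e))ᗮ.reflection
  have hL : L e₀ = e := Submodule.reflection_sub he₀
  rw [← L.measurePreserving.integral_comp L.toHomeomorph.measurableEmbedding]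
  have h1 : ∀ x, inner ℝ e (L x) = x i₀ := fun x => by
    rw [← hL, L.inner_map_map]
    simp [e₀, EuclideanSpace.inner_single_left]
  simp only [h1, LinearIsometryEquiv.norm_map]
  rw [← (PiLp.volume_preserving_toLp (Fin d)).integral_comp
    (MeasurableEquiv.toLp 2 (Fin d → ℝ)).measurableEmbedding]
  have h2 : ∀ y : Fin d → ℝ, (WithLp.toLp 2 y) i₀ ^ m * Real.exp (-‖WithLp.toLp 2 y‖ ^ 2) =
      ∏ i, (if i = i₀ then y i ^ m else 1) * Real.exp (-y i ^ 2) := fun y => by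
    rw [Finset.prod_mul_distrib, ← Real.exp_sum, EuclideanSpace.norm_sq_eq]
    simp
  refine (integral_congr_ae (.of_forall h2)).trans ?_
  rw [integral_fintype_prod_volume_eq_prod
    (fun (i : Fin d) (y : ℝ) => (if i = i₀ then y ^ m else 1) * Real.exp (-y ^ 2)),
    ← Finset.mul_prod_erase _ _ (Finset.mem_univ i₀)]
  congr 1
  rw [Finset.prod_eq_pow_card (b := √Real.pi)]
  · simp
  · intro i hi
    simpa [Finset.ne_of_mem_erase hi] using integral_gaussian 1

/-- Polar coordinates: the Gaussian integral factors into the spherical moment and a radial Gamma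
integral. -/
lemma integral_inner_pow_toSphere {d : ℕ} (hd : 0 < d)
    {e : EuclideanSpace ℝ (Fin d)} (he : ‖e‖ = 1) (m : ℕ) :
    (∫ v : Metric.sphere (0 : EuclideanSpace ℝ (Fin d)) 1, inner ℝ e v.1 ^ m
        ∂(volume : Measure (EuclideanSpace ℝ (Fin d))).toSphere) *
        (1 / 2 * Real.Gamma (((m : ℝ) + d) / 2)) =
      (∫ x : ℝ, x ^ m * Real.exp (-x ^ 2)) * √Real.pi ^ (d - 1) := by
  rw [← integral_inner_pow_mul_exp_neg_norm_sq hd he]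
  set μ := (volume : Measure (EuclideanSpace ℝ (Fin d)))
  have : Nonempty (Fin d) := ⟨⟨0, hd⟩⟩
  have hrad : ∫ r : Set.Ioi (0 : ℝ), r.1 ^ m * Real.exp (-r.1 ^ 2)
      ∂(Measure.volumeIoiPow (d - 1)) = 1 / 2 * Real.Gamma (((m : ℝ) + d) / 2) := by
    have h2 := integral_rpow_mul_exp_neg_rpow (p := 2) (q := (d - 1 + m : ℕ)) two_pos
      (by linarith [(Nat.cast_nonneg (d - 1 + m) : (0 : ℝ) ≤ (d - 1 + m : ℕ))])
    simp only [Real.rpow_natCast, Real.rpow_two] at h2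
    rw [show ((m : ℝ) + d) / 2 = ((d - 1 + m : ℕ) + 1) / 2 by
      push_cast [Nat.cast_sub (Nat.one_le_of_lt hd)]; ring, ← h2]
    simp only [Measure.volumeIoiPow, ENNReal.ofReal]
    rw [integral_withDensity_eq_integral_smul
        (measurable_subtype_coe.pow_const _).real_toNNReal,
      integral_subtype_comap measurableSet_Ioi fun a : ℝ =>
        Real.toNNReal (a ^ (d - 1)) • (a ^ m * Real.exp (-a ^ 2))]
    refine setIntegral_congr_fun measurableSet_Ioi fun x hx => ?_
    simp only [NNReal.smul_def, smul_eq_mul]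
    rw [Real.coe_toNNReal _ (pow_nonneg hx.out.le _), pow_add, mul_assoc]
  calc _ = ∫ x, inner ℝ e x.1.1 ^ m * (x.2.1 ^ m * Real.exp (-x.2.1 ^ 2))
        ∂μ.toSphere.prod (.volumeIoiPow (d - 1)) := by
        rw [integral_prod_mul (fun v : Metric.sphere (0 : EuclideanSpace ℝ (Fin d)) 1 =>
          inner ℝ e v.1 ^ m) (fun r : Set.Ioi (0 : ℝ) => r.1 ^ m * Real.exp (-r.1 ^ 2)), hrad]
    _ = ∫ x : ({(0)}ᶜ : Set (EuclideanSpace ℝ (Fin d))),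
          inner ℝ e x.1 ^ m * Real.exp (-‖x.1‖ ^ 2) ∂(μ.comap (↑)) := by
        have := μ.measurePreserving_homeomorphUnitSphereProd.integral_comp
          (Homeomorph.measurableEmbedding _) (fun x =>
            inner ℝ e x.1.1 ^ m * (x.2.1 ^ m * Real.exp (-x.2.1 ^ 2)))
        rw [finrank_euclideanSpace_fin] at this
        rw [← this]
        refine integral_congr_ae (.of_forall fun x => ?_)
        have hx : ‖x.1‖ ≠ 0 := norm_ne_zero_iff.2 x.2
        simp only [homeomorphUnitSphereProd_apply_snd_coe, homeomorphUnitSphereProd_apply_fst_coe,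
          inner_smul_right]
        rw [mul_pow, inv_pow]
        field_simp
    _ = _ := by
        rw [integral_subtype_comap (measurableSet_singleton _).compl
          fun x => inner ℝ e x ^ m * Real.exp (-‖x‖ ^ 2), restrict_compl_singleton]

lemma isProbabilityMeasure_uniformSphere {d : ℕ} (hd : 0 < d) :
    IsProbabilityMeasure (uniformSphere d) := by
  have : Nonempty (Fin d) := ⟨⟨0, hd⟩⟩
  refine ⟨?_⟩
  rw [uniformSphere, Measure.smul_apply, smul_eq_mul]
  refine ENNReal.inv_mul_cancel ?_ (measure_ne_top _ _)
  exact (Measure.measure_univ_ne_zero.2 (Measure.toSphere_ne_zero _))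

/-- The moments of the projection of a uniform random point of the sphere on a line. -/
theorem integral_inner_pow_uniformSphere {d : ℕ} (hd : 0 < d)
    {e : EuclideanSpace ℝ (Fin d)} (he : ‖e‖ = 1) (m : ℕ) :
    ∫ v, inner ℝ e v.1 ^ m ∂uniformSphere d =
      m.factorial * (Real.Gamma ((d : ℝ) / 2) * besselCoeff ((d : ℝ) / 2 - 1) m) := by
  have hm := integral_inner_pow_toSphere hd he m
  -- The case m = 0 determines the area of the sphere, used to normalize.
  have h0 := integral_inner_pow_toSphere hd he 0
  rw [integral_pow_mul_exp_neg_sq] at hm h0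
  have hd' : (0 : ℝ) < d := by exact_mod_cast hd
  have hG : 0 < Real.Gamma ((d : ℝ) / 2) := Real.Gamma_pos_of_pos (by positivity)
  have hGm : 0 < Real.Gamma (((m : ℝ) + d) / 2) := Real.Gamma_pos_of_pos (by positivity)
  have hpi : 0 < √Real.pi := Real.sqrt_pos.2 Real.pi_pos
  simp only [pow_zero, Even.zero, if_true, Nat.cast_zero, zero_add, Real.Gamma_one_half_eq,
    integral_const, smul_eq_mul, mul_one] at h0
  rw [uniformSphere, integral_smul_measure, smul_eq_mul, ENNReal.toReal_inv, ← measureReal_def]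
  set S := (volume : Measure (EuclideanSpace ℝ (Fin d))).toSphere.real Set.univ
  have hS : S ≠ 0 := fun h => by
    rw [h, zero_mul] at h0
    exact absurd h0.symm (by positivity)
  set I := ∫ v : Metric.sphere (0 : EuclideanSpace ℝ (Fin d)) 1, inner ℝ e v.1 ^ m
        ∂(volume : Measure (EuclideanSpace ℝ (Fin d))).toSphere
  split_ifs at hm with hev
  · obtain ⟨k, rfl⟩ := even_iff_exists_two_mul.1 hev
    have hk := Gamma_nat_add_half_mul k
    push_cast at hm hGm
    rw [show (2 * (k : ℝ) + 1) / 2 = k + 1 / 2 by ring] at hm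
    rw [besselCoeff_two_mul, show (d : ℝ) / 2 - 1 + k + 1 = (2 * k + d) / 2 by ring]
    have hkf := k.factorial_pos
    rw [inv_mul_eq_iff_eq_mul₀ hS]
    field_simp
    have hne : (√Real.pi * √Real.pi ^ (d - 1)) ≠ 0 := by positivity
    refine mul_right_cancel₀ hne ?_
    linear_combination (2 * 2 ^ (2 * k) * (k.factorial : ℝ) * √Real.pi * √Real.pi ^ (d - 1)) * hm -
      (2 * (2 * k).factorial * √Real.pi * √Real.pi ^ (d - 1)) * h0 +
      (2 * √Real.pi * (√Real.pi ^ (d - 1)) ^ 2) * hk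
  · rw [zero_mul] at hm
    rw [besselCoeff_of_not_even _ hev, (mul_eq_zero.1 hm).resolve_right (by positivity)]
    simp

/-! ### Moments of the walk with frozen step lengths -/

/-- The moments of a weighted sum of independent random variables whose exponential moment
generating function is a normalized Bessel series. -/
theorem integral_sum_mul_pow_eq_stepProductCoeff {Ω : Type*} [MeasurableSpace Ω] {μ : Measure Ω}
    [IsProbabilityMeasure μ] {ν G : ℝ} (n : ℕ) {X : ℕ → Ω → ℝ} (hX : ∀ k, Measurable (X k))
    (hX1 : ∀ k ω, |X k ω| ≤ 1) (hind : iIndepFun X μ)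
    (hmom : ∀ k m, ∫ ω, X k ω ^ m ∂μ = m.factorial * (G * besselCoeff ν m))
    (m : ℕ) (t : ℝ) (τ : ℕ → ℝ) :
    ∫ ω, (∑ k ∈ Finset.range n, τ k * X k ω + (t - ∑ k ∈ Finset.range n, τ k) * X n ω) ^ m ∂μ =
      m.factorial * (G ^ (n + 1) * stepProductCoeff ν n m t fun k => τ k) := by
  induction n generalizing X m t τ with
  | zero =>
    simp only [Finset.range_zero, Finset.sum_empty, zero_add, sub_zero, mul_pow, stepProductCoeff,
      integral_const_mul, hmom, pow_one]
    ring
  | succ n ih =>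
    have ih' := fun l => ih (X := fun k => X (k + 1)) (fun k => hX _) (fun k => hX1 _)
      (hind.precomp (add_left_injective 1)) (fun k => hmom _) l (t - τ 0) (fun k => τ (k + 1))
    set Y : Ω → ℝ := fun ω => ∑ k ∈ Finset.range n, τ (k + 1) * X (k + 1) ω +
      (t - τ 0 - ∑ k ∈ Finset.range n, τ (k + 1)) * X (n + 1) ω with hY
    have hYm : Measurable Y := by fun_prop
    have hsplit (ω) : ∑ k ∈ Finset.range (n + 1), τ k * X k ω +
        (t - ∑ k ∈ Finset.range (n + 1), τ k) * X (n + 1) ω = τ 0 * X 0 ω + Y ω := by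
      simp only [Finset.sum_range_succ', hY]
      ring
    have hindY : IndepFun (X 0) Y μ := by
      -- These weights present the remainder as a sum over the indices 1, …, n + 1 of one
      -- independent family, the last weight being the residual time.
      let c : ℕ → ℝ := fun k => if k = 0 then 1 else if k < n + 1 then τ k else
        t - τ 0 - ∑ k ∈ Finset.range n, τ (k + 1)
      have h1 : iIndepFun (fun k ω => c k * X k ω) μ :=
        hind.comp (fun k x => c k * x) (fun k => measurable_const_mul _)
      have h2 := h1.indepFun_finsetSum_of_notMem (fun k => (hX k).const_mul _)
        (s := (Finset.range (n + 1)).image (· + 1)) (i := 0) (by simp)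
      have h3 : (∑ j ∈ (Finset.range (n + 1)).image (· + 1), fun ω => c j * X j ω) = Y := by
        ext ω
        rw [Finset.sum_image (fun a _ b _ h => by simpa using h), Finset.sum_apply,
          Finset.sum_range_succ]
        simp only [c, hY]
        congr 1
        · refine Finset.sum_congr rfl fun k hk => ?_
          have := Finset.mem_range.1 hk
          simp [this]
        · simp
      rw [h3] at h2
      simpa [c] using h2.symm
    have hbdd : ∃ C, ∀ ω, |Y ω| ≤ C := by
      refine ⟨∑ k ∈ Finset.range n, |τ (k + 1)| +
        |t - τ 0 - ∑ k ∈ Finset.range n, τ (k + 1)|, fun ω => ?_⟩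
      refine (abs_add_le _ _).trans (add_le_add ((Finset.abs_sum_le_sum_abs _ _).trans
        (Finset.sum_le_sum fun k _ => ?_)) ?_)
      all_goals
        rw [abs_mul]
        exact mul_le_of_le_one_right (abs_nonneg _) (hX1 _ _)
    obtain ⟨C, hC⟩ := hbdd
    have hintX (k : ℕ) : Integrable (fun ω => X 0 ω ^ k) μ :=
      .of_bound ((hX 0).pow_const k).aestronglyMeasurable 1 (.of_forall fun ω => by
        rw [norm_pow]; exact pow_le_one₀ (norm_nonneg _) (hX1 0 ω))
    have hintY (k : ℕ) : Integrable (fun ω => Y ω ^ k) μ :=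
      .of_bound (hYm.pow_const k).aestronglyMeasurable (C ^ k) (.of_forall fun ω => by
        rw [norm_pow]; exact pow_le_pow_left₀ (norm_nonneg _) (hC ω) k)
    have hindp (k l : ℕ) : IndepFun (fun ω => X 0 ω ^ k) (fun ω => Y ω ^ l) μ :=
      hindY.comp (measurable_id.pow_const k) (measurable_id.pow_const l)
    -- Each of the two moments carries its own factorial, and binom(k + l, k) k! l! = m! restores
    -- the one in the claim.
    have hbin (a b : ℝ) := (Commute.all a b).add_pow' m
    simp only [hsplit, hbin, nsmul_eq_mul, mul_pow]
    have hterm (k l : ℕ) : Integrable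
        (fun ω => ((m.choose k : ℕ) : ℝ) * (τ 0 ^ k * X 0 ω ^ k * Y ω ^ l)) μ := by
      simp only [mul_assoc]
      exact (((hindp k l).integrable_mul (hintX k) (hintY l)).const_mul _).const_mul _
    rw [integral_finsetSum _ fun kl _ => hterm kl.1 kl.2]
    simp only [stepProductCoeff, Finset.mul_sum]
    refine Finset.sum_congr rfl fun kl hkl => ?_
    obtain rfl := Finset.HasAntidiagonal.mem_antidiagonal.1 hkl
    have hmul : ∫ ω, X 0 ω ^ kl.1 * Y ω ^ kl.2 ∂μ =
        (∫ ω, X 0 ω ^ kl.1 ∂μ) * ∫ ω, Y ω ^ kl.2 ∂μ :=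
      (hindp kl.1 kl.2).integral_fun_mul_eq_mul_integral (hintX _).1 (hintY _).1
    rw [integral_const_mul]
    simp only [mul_assoc]
    rw [integral_const_mul, hmul, hmom, ih', ← Nat.add_choose_mul_factorial_mul_factorial,
      Nat.choose_symm_add]
    have htail : (Fin.tail fun k : Fin (n + 1) => τ k) = fun k : Fin n => τ (k + 1) := rfl
    rw [htail]
    push_cast
    simp only [Fin.val_zero]
    ring

/-! ### Averages over the generalized Dirichlet law -/

/-- At order 0 the step lengths disappear, so the mean is known from the total mass alone; this
calibrates all other orders. -/
lemma stepProductCoeff_zero (ν : ℝ) (n : ℕ) (t : ℝ) (τ : Fin n → ℝ) :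
    stepProductCoeff ν n 0 t τ = besselCoeff ν 0 ^ (n + 1) := by
  induction n generalizing t with
  | zero => simp [stepProductCoeff]
  | succ n ih => simp [stepProductCoeff, ih, pow_succ' _ (n + 1)]

lemma besselCoeff_zero_pos {ν : ℝ} (hν : 0 < ν) : 0 < besselCoeff ν 0 := by
  have : 0 < Real.Gamma (ν + 1) := Real.Gamma_pos_of_pos (by positivity)
  simpa [besselCoeff] using this

lemma integral_stepProductCoeff_genDirichlet {h : ℝ} (hh : 0 < h) {n : ℕ} {b : Fin n → ℝ}
    (hb : ∀ k, 1 - h + ∑ i ∈ Finset.Ici k, (b i - 1) = 0 ∨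
      1 - h + ∑ i ∈ Finset.Ici k, (b i - 1) = 1) {t : ℝ} (ht : 0 < t)
    [hP : IsProbabilityMeasure (genDirichlet (fun _ => h) b t)] (m : ℕ) :
    ∫ τ, stepProductCoeff h n m t τ ∂genDirichlet (fun _ => h) b t =
      besselCoeff h 0 ^ (n + 1) *
        (besselCoeff ((n + 1) * h) m / besselCoeff ((n + 1) * h) 0 * t ^ m) := by
  obtain ⟨κ, hκ, hI⟩ := exists_lintegral_switchWeight_mul_stepProductCoeff hh n b hb
  set C := genDirichletConst (fun _ => h) b t
  have hy : 0 < ((n : ℝ) + 1) * h := by positivity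
  have hms (m : ℕ) : Measurable fun τ : Fin n → ℝ => stepProductCoeff h n m t τ :=
    (measurable_stepProductCoeff h n m).comp (measurable_prodMk_left (x := t))
  have hmw : Measurable fun τ : Fin n → ℝ => switchWeight h b t τ :=
    (measurable_switchWeight h b).comp (measurable_prodMk_left (x := t))
  have hpdf (τ : Fin n → ℝ) : genDirichletPDF (fun _ => h) b t τ = C * switchWeight h b t τ := rfl
  have hsupp : ∀ᵐ τ ∂genDirichlet (fun _ => h) b t, τ ∈ timeSimplex n t :=
    (withDensity_absolutelyContinuous _ _).ae_le (ae_restrict_mem (measurableSet_timeSimplex _ _))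
  -- `max C 0` comes from `ENNReal.ofReal C`; the sign of C need not be known, since the whole
  -- prefactor is eliminated by comparison with m = 0.
  have hmom (m : ℕ) : ∫ τ, stepProductCoeff h n m t τ ∂genDirichlet (fun _ => h) b t =
      max C 0 * (κ * t ^ (n * h + ∑ i, (b i - 1))) * (besselCoeff ((n + 1) * h) m * t ^ m) := by
    rw [integral_eq_lintegral_of_nonneg_ae (hsupp.mono fun τ hτ =>
      stepProductCoeff_nonneg hh n m ht hτ) (hms m).aestronglyMeasurable, genDirichlet,
      lintegral_withDensity_eq_lintegral_mul _ (by simp only [hpdf]; fun_prop) (by fun_prop)]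
    have : ∫⁻ τ in timeSimplex n t, ((fun τ => ENNReal.ofReal (genDirichletPDF (fun _ => h) b t τ)) *
        fun τ => ENNReal.ofReal (stepProductCoeff h n m t τ)) τ =
        ENNReal.ofReal C * ∫⁻ τ in timeSimplex n t,
          ENNReal.ofReal (switchWeight h b t τ * stepProductCoeff h n m t τ) := by
      rw [← lintegral_const_mul' _ _ ENNReal.ofReal_ne_top]
      refine setLIntegral_congr_fun (measurableSet_timeSimplex _ _) fun τ hτ => ?_
      simp only [Pi.mul_apply, hpdf]
      rw [ENNReal.ofReal_mul' (switchWeight_nonneg h b hτ),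
        ENNReal.ofReal_mul (switchWeight_nonneg h b hτ), mul_assoc]
    have hbm := besselCoeff_nonneg hy m
    rw [this, hI t ht, ENNReal.toReal_mul, ENNReal.toReal_ofReal', ENNReal.toReal_ofReal
      (by positivity), Real.rpow_add ht, Real.rpow_natCast]
    ring
  have h0 := hmom 0
  simp only [stepProductCoeff_zero, integral_const, probReal_univ, one_smul, pow_zero,
    mul_one] at h0
  rw [hmom, h0]
  have := (besselCoeff_zero_pos hy).ne'
  rw [mul_assoc _ (besselCoeff _ 0), ← mul_assoc (besselCoeff _ 0), mul_div_cancel₀ _ this]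

/-- The last entry contributes d/2 - 2, which cancels the constant 1 - (d/2 - 1). What remains is 1
if the entry equal to 2 by the choice of j lies in the tail starting at k, and 0 otherwise. -/
lemma switchB_partial_sums (d j n : ℕ) (k : Fin n) :
    1 - ((d : ℝ) / 2 - 1) + ∑ i ∈ Finset.Ici k, (switchB d j n i - 1) = 0 ∨
      1 - ((d : ℝ) / 2 - 1) + ∑ i ∈ Finset.Ici k, (switchB d j n i - 1) = 1 := by
  obtain _ | n := n
  · exact k.elim0
  have h1 (i : Fin (n + 1)) : switchB d j (n + 1) i - 1 =
      (if Fin.last n = i then (d : ℝ) / 2 - 1 - 1 else 0) +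
        if (i : ℕ) + 1 = j ∧ (i : ℕ) ≠ n then 1 else 0 := by
    have : Fin.last n = i ↔ (i : ℕ) = n := by rw [Fin.ext_iff, eq_comm]; rfl
    simp only [switchB, this, Nat.add_right_cancel_iff]
    split_ifs <;> simp_all
    norm_num
  simp only [h1, Finset.sum_add_distrib, Finset.sum_ite_eq, Finset.mem_Ici, Fin.le_last, if_true]
  by_cases hj : 1 ≤ j ∧ j ≤ n
  · have h2 (i : Fin (n + 1)) : ((i : ℕ) + 1 = j ∧ (i : ℕ) ≠ n) ↔
        (⟨j - 1, by omega⟩ : Fin (n + 1)) = i := by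
      rw [Fin.ext_iff]
      simp only
      omega
    simp only [h2, Finset.sum_ite_eq]
    split_ifs
    · exact .inr (by ring)
    · exact .inl (by ring)
  · have h2 (i : Fin (n + 1)) : ¬ ((i : ℕ) + 1 = j ∧ (i : ℕ) ≠ n) := by
      have := i.2
      omega
    simp only [h2, if_false, Finset.sum_const_zero]
    exact .inl (by ring)

/-! ### The walk and its projections -/

lemma sum_lt_of_mem_timeSimplex {n : ℕ} {t : ℝ} (ht : 0 < t) {τ : ℕ → ℝ}
    (hτ : (fun k : Fin n => τ k) ∈ timeSimplex n t) :
    (∀ k ∈ Finset.range n, 0 < τ k) ∧ ∑ k ∈ Finset.range n, τ k < t := by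
  refine ⟨fun k hk => (hτ ⟨k, Finset.mem_range.1 hk⟩).1, ?_⟩
  obtain _ | n := n
  · simpa using ht
  have h1 := (hτ (Fin.last n)).2
  have h2 : ∑ i ∈ Finset.Iio (Fin.last n), τ i = ∑ k ∈ Finset.range n, τ k := by
    rw [← Fin.sum_univ_eq_sum_range, Fin.Iio_last_eq_map, Finset.sum_map]
    rfl
  simp only [h2, Fin.val_last] at h1
  rw [Finset.sum_range_succ]
  linarith

lemma norm_walkPosition_le {d : ℕ} {c t : ℝ} (hc : 0 < c) (ht : 0 < t) {n : ℕ} {τ : ℕ → ℝ}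
    (hτ : (fun k : Fin n => τ k) ∈ timeSimplex n t)
    (v : ℕ → Metric.sphere (0 : EuclideanSpace ℝ (Fin d)) 1) :
    ‖walkPosition c t n τ v‖ ≤ c * t := by
  obtain ⟨h1, h2⟩ := sum_lt_of_mem_timeSimplex ht hτ
  rw [walkPosition, norm_smul, Real.norm_of_nonneg hc.le]
  refine mul_le_mul_of_nonneg_left ?_ hc.le
  calc _ ≤ ∑ k ∈ Finset.range n, τ k + (t - ∑ k ∈ Finset.range n, τ k) := by
        refine (norm_add_le _ _).trans (add_le_add ((norm_sum_le _ _).trans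
          (Finset.sum_le_sum fun k hk => ?_)) ?_)
        · rw [norm_smul, norm_eq_of_mem_sphere, mul_one, Real.norm_of_nonneg (h1 k hk).le]
        · rw [norm_smul, norm_eq_of_mem_sphere, mul_one, Real.norm_of_nonneg (by linarith)]
    _ = t := by ring

lemma inner_walkPosition {d : ℕ} (e : EuclideanSpace ℝ (Fin d)) (c t : ℝ) (n : ℕ) (τ : ℕ → ℝ)
    (v : ℕ → Metric.sphere (0 : EuclideanSpace ℝ (Fin d)) 1) :
    inner ℝ e (walkPosition c t n τ v) =
      c * (∑ k ∈ Finset.range n, τ k * inner ℝ e (v k).1 +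
        (t - ∑ k ∈ Finset.range n, τ k) * inner ℝ e (v n).1) := by
  simp [walkPosition, inner_smul_right, inner_add_right, inner_sum, mul_add]

lemma measurable_walkPosition {d : ℕ} (c t : ℝ) (n : ℕ) :
    Measurable fun p : (ℕ → ℝ) × (ℕ → Metric.sphere (0 : EuclideanSpace ℝ (Fin d)) 1) =>
      walkPosition c t n p.1 p.2 := by
  unfold walkPosition
  fun_prop

namespace IsSwitchWalk

variable {Ω : Type*} [MeasurableSpace Ω] {μ : Measure Ω} [IsProbabilityMeasure μ] {d j : ℕ}
  {lam : ℝ} {N : ℝ → Ω → ℕ} {T : ℝ → ℕ → Ω → ℝ}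
  {V : ℕ → Ω → Metric.sphere (0 : EuclideanSpace ℝ (Fin d)) 1}

lemma ae_mem_timeSimplex (hW : IsSwitchWalk μ d j lam N T V) {t : ℝ} (ht : 0 < t) :
    ∀ᵐ ω ∂μ, (fun k : Fin (N t ω) => T t k ω) ∈ timeSimplex (N t ω) t := by
  have key (n : ℕ) : ∀ᵐ ω ∂μ, N t ω = n → (fun k : Fin n => T t k ω) ∈ timeSimplex n t := by
    obtain _ | n := n
    · exact .of_forall fun ω _ k => k.elim0
    have hT : Measurable fun ω (k : Fin (n + 1)) => T t k ω :=
      measurable_pi_iff.2 fun k => hW.measurable_T t ht k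
    have hA : MeasurableSet (N t ⁻¹' {n + 1}) := hW.measurable_N t ht (measurableSet_singleton _)
    have h1 : ∀ᵐ τ ∂genDirichlet (switchA d (n + 1)) (switchB d j (n + 1)) t,
        τ ∈ timeSimplex (n + 1) t :=
      (withDensity_absolutelyContinuous _ _).ae_le
        (ae_restrict_mem (measurableSet_timeSimplex _ _))
    rw [← hW.law_T t ht (n + 1) (by omega)] at h1
    have h2 := ae_of_ae_map hT.aemeasurable h1
    rw [ProbabilityTheory.cond, Measure.ae_ennreal_smul_measure_iff (by simp),
      ae_restrict_iff' hA] at h2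
    exact h2
  filter_upwards [ae_all_iff.2 key] with ω hω using hω _ rfl

/-- Independence and Fubini: the number of deviations and the step lengths are frozen while the
directions are integrated out. -/
lemma integral_inner_pow (hW : IsSwitchWalk μ d j lam N T V) (hd : 0 < d) {c t : ℝ} (hc : 0 < c)
    (ht : 0 < t) (n m : ℕ) {e : EuclideanSpace ℝ (Fin d)} (he : ‖e‖ = 1) :
    ∫ ω in N t ⁻¹' {n}, inner ℝ e (walkPosition c t n (fun k => T t k ω) fun k => V k ω) ^ m ∂μ =
      c ^ m * (m.factorial * (Real.Gamma ((d : ℝ) / 2) ^ (n + 1) *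
        ∫ ω in N t ⁻¹' {n},
          stepProductCoeff ((d : ℝ) / 2 - 1) n m t (fun k => T t k ω) ∂μ)) := by
  -- Restricting to the simplex, which almost surely changes nothing on N t = n, bounds the
  -- integrand by (c t)^m everywhere; this gives the integrability Fubini needs.
  let B : Set (ℕ × (ℕ → ℝ)) := {p | p.1 = n ∧ (fun k : Fin n => p.2 k) ∈ timeSimplex n t}
  have hB : MeasurableSet B := ((measurable_fst (measurableSet_singleton n))).inter
    ((measurableSet_timeSimplex n t).preimage (by fun_prop))
  let F : (ℕ × (ℕ → ℝ)) × (ℕ → Metric.sphere (0 : EuclideanSpace ℝ (Fin d)) 1) → ℝ := fun q =>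
    B.indicator (fun p => inner ℝ e (walkPosition c t n p.2 q.2) ^ m) q.1
  have hFm : Measurable F := by
    have h1 : Measurable fun q : (ℕ × (ℕ → ℝ)) × (ℕ → Metric.sphere
        (0 : EuclideanSpace ℝ (Fin d)) 1) => inner ℝ e (walkPosition c t n q.1.2 q.2) ^ m :=
      (Measurable.const_inner ((measurable_walkPosition c t n).comp
        (f := fun q : (ℕ × (ℕ → ℝ)) × (ℕ → Metric.sphere (0 : EuclideanSpace ℝ (Fin d)) 1) =>
          (q.1.2, q.2)) (by fun_prop))).pow_const m
    exact h1.indicator (hB.preimage measurable_fst)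
  have hFb (q) : ‖F q‖ ≤ (c * t) ^ m := by
    by_cases hq : q.1 ∈ B
    · simp only [F, Set.indicator_of_mem hq, norm_pow]
      refine pow_le_pow_left₀ (norm_nonneg _) ((norm_inner_le_norm _ _).trans ?_) m
      rw [he, one_mul]
      exact norm_walkPosition_le hc ht hq.2 _
    · simp only [F, Set.indicator_of_notMem hq, norm_zero]
      positivity
  have hNm := hW.measurable_N t ht
  have hTm := hW.measurable_T t ht
  have hVm := hW.measurable_V
  have hNT : Measurable fun ω => (N t ω, fun k => T t k ω) := by fun_prop
  have hV : Measurable fun ω k => V k ω := by fun_prop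
  have hA : MeasurableSet (N t ⁻¹' {n}) := hNm (measurableSet_singleton _)
  have hset (f : Ω → ℝ) : ∫ ω in N t ⁻¹' {n}, f ω ∂μ =
      ∫ ω, B.indicator (fun _ => f ω) (N t ω, fun k => T t k ω) ∂μ := by
    rw [← integral_indicator hA]
    refine integral_congr_ae ?_
    filter_upwards [hW.ae_mem_timeSimplex ht] with ω hω
    by_cases hn : N t ω = n
    · have h1 : ω ∈ N t ⁻¹' {n} := hn
      have h2 : (N t ω, fun k => T t k ω) ∈ B := ⟨hn, hn ▸ hω⟩
      rw [Set.indicator_of_mem h1, Set.indicator_of_mem h2]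
    · have h1 : ω ∉ N t ⁻¹' {n} := hn
      have h2 : (N t ω, fun k => T t k ω) ∉ B := fun h => hn h.1
      rw [Set.indicator_of_notMem h1, Set.indicator_of_notMem h2]
  have : IsProbabilityMeasure (μ.map fun ω => (N t ω, fun k => T t k ω)) :=
    Measure.isProbabilityMeasure_map hNT.aemeasurable
  have : IsProbabilityMeasure (μ.map fun ω k => V k ω) :=
    Measure.isProbabilityMeasure_map hV.aemeasurable
  have hinner (τ : ℕ → ℝ) :
      ∫ ω, inner ℝ e (walkPosition c t n τ fun k => V k ω) ^ m ∂μ =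
        c ^ m * (m.factorial * (Real.Gamma ((d : ℝ) / 2) ^ (n + 1) *
          stepProductCoeff ((d : ℝ) / 2 - 1) n m t fun k => τ k)) := by
    simp only [inner_walkPosition, mul_pow, integral_const_mul]
    congr 1
    refine integral_sum_mul_pow_eq_stepProductCoeff n (X := fun k ω => inner ℝ e (V k ω).1)
      (fun k => by fun_prop) (fun k ω => ?_) ?_ (fun k m => ?_) m t τ
    · refine (abs_real_inner_le_norm _ _).trans ?_
      simp [he]
    · exact hW.indep_V.comp (fun _ v => inner ℝ e v.1) (fun _ => by fun_prop)
    · rw [← integral_inner_pow_uniformSphere hd he, ← hW.law_V k, integral_map (by fun_prop)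
        (by fun_prop)]
  calc _ = ∫ ω, F ((N t ω, fun k => T t k ω), fun k => V k ω) ∂μ := by
        rw [hset]
        rfl
    _ = ∫ q, F q ∂((μ.map fun ω => (N t ω, fun k => T t k ω)).prod (μ.map fun ω k => V k ω)) := by
        rw [← (indepFun_iff_map_prod_eq_prod_map_map hNT.aemeasurable hV.aemeasurable).1
          (hW.indep t ht).symm, integral_map (hNT.prodMk hV).aemeasurable
          hFm.aestronglyMeasurable]
    _ = ∫ ω, ∫ ω', F ((N t ω, fun k => T t k ω), fun k => V k ω') ∂μ ∂μ := by
        rw [integral_prod _ (.of_bound hFm.aestronglyMeasurable _ (.of_forall hFb)),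
          integral_map hNT.aemeasurable
            hFm.stronglyMeasurable.integral_prod_right.aestronglyMeasurable]
        refine integral_congr_ae (.of_forall fun ω => ?_)
        exact integral_map hV.aemeasurable
          (hFm.comp measurable_prodMk_left).aestronglyMeasurable
    _ = _ := by
        rw [← integral_const_mul, ← integral_const_mul, ← integral_const_mul, hset]
        refine integral_congr_ae (.of_forall fun ω => ?_)
        by_cases hq : (N t ω, fun k => T t k ω) ∈ B
        · simp only [F, Set.indicator_of_mem hq]
          exact hinner _
        · simp [F, Set.indicator_of_notMem hq]

end IsSwitchWalk

/-! ### Moment determinacy and Beta moments -/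

/-- Finite measures on the unit interval with the same moments integrate continuous functions
equally. -/
theorem integral_eq_of_moments_eq {ρ₁ ρ₂ : Measure ℝ} [IsFiniteMeasure ρ₁] [IsFiniteMeasure ρ₂]
    (h₁ : ∀ᵐ x ∂ρ₁, x ∈ Set.Icc (0 : ℝ) 1) (h₂ : ∀ᵐ x ∂ρ₂, x ∈ Set.Icc (0 : ℝ) 1)
    (h : ∀ q : ℕ, ∫ x, x ^ q ∂ρ₁ = ∫ x, x ^ q ∂ρ₂) {f : ℝ → ℝ} (hf : Continuous f) :
    ∫ x, f x ∂ρ₁ = ∫ x, f x ∂ρ₂ := by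
  have hint {ρ : Measure ℝ} [IsFiniteMeasure ρ] (hρ : ∀ᵐ x ∂ρ, x ∈ Set.Icc (0 : ℝ) 1)
      {g : ℝ → ℝ} (hg : Continuous g) : Integrable g ρ := by
    obtain ⟨C, hC⟩ := isCompact_Icc.exists_bound_of_continuousOn (hg.continuousOn (s := Set.Icc 0 1))
    exact .of_bound hg.aestronglyMeasurable C (hρ.mono hC)
  have hpoly (P : Polynomial ℝ) : ∫ x, P.eval x ∂ρ₁ = ∫ x, P.eval x ∂ρ₂ := by
    simp only [Polynomial.eval_eq_sum_range]
    rw [integral_finsetSum _ fun i _ => hint h₁ (by fun_prop),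
      integral_finsetSum _ fun i _ => hint h₂ (by fun_prop)]
    simp only [integral_const_mul, h]
  have hdist {ρ : Measure ℝ} [IsFiniteMeasure ρ] (hρ : ∀ᵐ x ∂ρ, x ∈ Set.Icc (0 : ℝ) 1) {ε : ℝ}
      {P : Polynomial ℝ} (hP : ∀ x ∈ Set.Icc (0 : ℝ) 1, |P.eval x - f x| < ε) :
      |∫ x, P.eval x ∂ρ - ∫ x, f x ∂ρ| ≤ ε * ρ.real Set.univ := by
    rw [← integral_sub (hint hρ (by fun_prop)) (hint hρ hf)]
    exact norm_integral_le_of_norm_le_const (f := fun x => P.eval x - f x)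
      (hρ.mono fun x hx => (hP x hx).le)
  refine eq_of_forall_dist_le fun ε hε => ?_
  set M := ρ₁.real Set.univ + ρ₂.real Set.univ with hM
  have hM0 : 0 ≤ M := by positivity
  -- The tolerance is divided by M + 1 rather than M, as both measures may be zero.
  obtain ⟨P, hP⟩ := exists_polynomial_near_of_continuousOn 0 1 f hf.continuousOn (ε / (M + 1))
    (by positivity)
  have e1 := hdist h₁ hP
  have e2 := hdist h₂ hP
  rw [hpoly] at e1
  rw [abs_sub_comm] at e1
  calc dist (∫ x, f x ∂ρ₁) (∫ x, f x ∂ρ₂) ≤ ε / (M + 1) * M := by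
        rw [Real.dist_eq]
        refine (abs_sub_le _ (∫ x, P.eval x ∂ρ₂) _).trans ((add_le_add e1 e2).trans ?_)
        rw [hM, mul_add]
    _ ≤ ε := by
        rw [div_mul_eq_mul_div, div_le_iff₀ (by positivity)]
        nlinarith

lemma measurable_betaPDF (a b : ℝ) : Measurable (betaPDF a b) :=
  (measurable_betaPDFReal a b).ennreal_ofReal

lemma betaPDF_eq_zero_of_notMem_Ioo {a b x : ℝ} (hx : x ∉ Set.Ioo (0 : ℝ) 1) :
    betaPDF a b x = 0 := by
  rw [betaPDF_eq, if_neg (show ¬(0 < x ∧ x < 1) from hx), ENNReal.ofReal_zero]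

lemma ae_mem_Ioo_betaMeasure (a b : ℝ) : ∀ᵐ x ∂betaMeasure a b, x ∈ Set.Ioo (0 : ℝ) 1 := by
  rw [betaMeasure, ae_withDensity_iff (measurable_betaPDF a b)]
  refine .of_forall fun x hx => ?_
  by_contra h
  exact hx (betaPDF_eq_zero_of_notMem_Ioo h)

lemma integral_rpow_betaMeasure {a b s : ℝ} (ha : 0 < a) (hb : 0 < b) (hs : 0 ≤ s) :
    ∫ x, x ^ s ∂betaMeasure a b = beta (a + s) b / beta a b := by
  have hB := beta_pos ha hb
  have hB' := beta_pos (by positivity : 0 < a + s) hb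
  rw [integral_eq_lintegral_of_nonneg_ae
    ((ae_mem_Ioo_betaMeasure a b).mono fun x hx => Real.rpow_nonneg hx.1.le s)
    (by fun_prop), betaMeasure, lintegral_withDensity_eq_lintegral_mul _
    (measurable_betaPDF a b) (by fun_prop)]
  have : ∫⁻ x, (betaPDF a b * fun x => ENNReal.ofReal (x ^ s)) x =
      ENNReal.ofReal (1 / beta a b) * ∫⁻ x in Set.Ioo (0 : ℝ) 1,
        ENNReal.ofReal (x ^ (a + s - 1) * (1 - x) ^ (b - 1)) := by
    rw [← lintegral_const_mul' _ _ ENNReal.ofReal_ne_top, ← lintegral_indicator measurableSet_Ioo]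
    refine lintegral_congr fun x => ?_
    by_cases hx : x ∈ Set.Ioo (0 : ℝ) 1
    · have hx1 : 0 < 1 - x := sub_pos.2 hx.2
      have hx0 := hx.1
      rw [Set.indicator_of_mem hx, Pi.mul_apply, betaPDF_of_pos_lt_one hx.1 hx.2,
        ← ENNReal.ofReal_mul (by positivity), ← ENNReal.ofReal_mul (by positivity),
        show a + s - 1 = (a - 1) + s by ring, Real.rpow_add hx0]
      congr 1
      ring
    · rw [Set.indicator_of_notMem hx, Pi.mul_apply, betaPDF_eq_zero_of_notMem_Ioo hx,
        zero_mul]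
  rw [this, lintegral_Ioo_rpow_mul_rpow (by positivity) hb one_pos, Real.one_rpow, mul_one,
    ENNReal.toReal_mul, ENNReal.toReal_ofReal (by positivity), ENNReal.toReal_ofReal hB'.le]
  ring

lemma integral_inner_pow_uniformSphere' {d : ℕ} (hd : 0 < d)
    (z : EuclideanSpace ℝ (Fin d)) (m : ℕ) :
    ∫ v, inner ℝ v.1 z ^ m ∂uniformSphere d =
      ‖z‖ ^ m * (m.factorial * (Real.Gamma ((d : ℝ) / 2) * besselCoeff ((d : ℝ) / 2 - 1) m)) := by
  obtain ⟨e, he, hz⟩ : ∃ e : EuclideanSpace ℝ (Fin d), ‖e‖ = 1 ∧ z = ‖z‖ • e := by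
    by_cases h : z = 0
    · exact ⟨EuclideanSpace.single ⟨0, hd⟩ 1, by simp, by simp [h]⟩
    · exact ⟨‖z‖⁻¹ • z, norm_smul_inv_norm h, by simp [smul_smul, h]⟩
  rw [← integral_inner_pow_uniformSphere hd he, ← integral_const_mul]
  congr 1
  ext v
  conv_lhs => rw [hz, inner_smul_right, mul_pow, real_inner_comm]

lemma IsSwitchWalk.measurable_walk {Ω : Type*} [MeasurableSpace Ω] {μ : Measure Ω} {d j : ℕ}
    {lam : ℝ} {N : ℝ → Ω → ℕ} {T : ℝ → ℕ → Ω → ℝ}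
    {V : ℕ → Ω → Metric.sphere (0 : EuclideanSpace ℝ (Fin d)) 1}
    (hW : IsSwitchWalk μ d j lam N T V) (c : ℝ) {t : ℝ} (ht : 0 < t)
    (n : ℕ) :
    Measurable fun ω => walkPosition c t n (fun k => T t k ω) fun k => V k ω := by
  have hTm := hW.measurable_T t ht
  have hVm := hW.measurable_V
  exact (measurable_walkPosition c t n).comp
    (f := fun ω => ((fun k => T t k ω), fun k => V k ω)) (by fun_prop)

lemma IsSwitchWalk.measurable_distanceProcess {Ω : Type*} [MeasurableSpace Ω] {μ : Measure Ω}
    {d j : ℕ} {lam : ℝ} {N : ℝ → Ω → ℕ} {T : ℝ → ℕ → Ω → ℝ}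
    {V : ℕ → Ω → Metric.sphere (0 : EuclideanSpace ℝ (Fin d)) 1}
    (hW : IsSwitchWalk μ d j lam N T V) (c : ℝ) {t : ℝ} (ht : 0 < t) :
    Measurable (distanceProcess c N T V t) := by
  let g : Ω × ℕ → EuclideanSpace ℝ (Fin d) := fun q =>
    walkPosition c t q.2 (fun k => T t k q.1) fun k => V k q.1
  have hg : Measurable g := measurable_from_prod_countable_left fun n => hW.measurable_walk c ht n
  have hN : Measurable fun ω => (ω, N t ω) := measurable_id.prodMk (hW.measurable_N t ht)
  exact (hg.comp hN).norm

/-! ### Moments of the distance given the number of deviations -/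

namespace IsSwitchWalk

variable {Ω : Type*} [MeasurableSpace Ω] {μ : Measure Ω} [IsProbabilityMeasure μ] {d j : ℕ}
  {lam : ℝ} {N : ℝ → Ω → ℕ} {T : ℝ → ℕ → Ω → ℝ}
  {V : ℕ → Ω → Metric.sphere (0 : EuclideanSpace ℝ (Fin d)) 1}

lemma setIntegral_stepProductCoeff (hW : IsSwitchWalk μ d j lam N T V) (hd : 3 ≤ d) {t : ℝ}
    (ht : 0 < t) (n m : ℕ) {h : ℝ} (hh : h = (d : ℝ) / 2 - 1) :
    ∫ ω in N t ⁻¹' {n}, stepProductCoeff h n m t (fun k => T t k ω) ∂μ =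
      μ.real (N t ⁻¹' {n}) * (besselCoeff h 0 ^ (n + 1) *
        (besselCoeff ((n + 1) * h) m / besselCoeff ((n + 1) * h) 0 * t ^ m)) := by
  have hd' : (3 : ℝ) ≤ d := by exact_mod_cast hd
  have hpos : 0 < h := by rw [hh]; linarith
  obtain rfl | hn := Nat.eq_zero_or_pos n
  · have := (besselCoeff_zero_pos hpos).ne'
    simp only [stepProductCoeff, setIntegral_const, smul_eq_mul, Nat.cast_zero, zero_add, one_mul,
      pow_one]
    field_simp
  by_cases hA0 : μ (N t ⁻¹' {n}) = 0
  · rw [measureReal_def, hA0, Measure.restrict_eq_zero.2 hA0]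
    simp
  have hTm : Measurable fun ω (k : Fin n) => T t k ω :=
    measurable_pi_iff.2 fun k => hW.measurable_T t ht k
  have hlaw := hW.law_T t ht n hn
  have : IsProbabilityMeasure (μ[|N t ⁻¹' {n}]) := cond_isProbabilityMeasure hA0
  have hsA : switchA d n = fun _ => h := by rw [hh]; rfl
  -- The Dirichlet law has mass one because it is the conditional law of the step lengths, not by
  -- computing its constant.
  have hP : IsProbabilityMeasure (genDirichlet (fun _ => h) (switchB d j n) t) := by
    rw [← hsA, ← hlaw]
    exact Measure.isProbabilityMeasure_map hTm.aemeasurable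
  have hsm : Measurable fun τ : Fin n → ℝ => stepProductCoeff h n m t τ :=
    (measurable_stepProductCoeff h n m).comp (measurable_prodMk_left (x := t))
  rw [← integral_stepProductCoeff_genDirichlet hpos (b := switchB d j n)
    (hh ▸ switchB_partial_sums d j n) ht, ← hsA, ← hlaw, integral_map hTm.aemeasurable
    hsm.aestronglyMeasurable, ProbabilityTheory.cond,
    integral_smul_measure, ENNReal.toReal_inv, smul_eq_mul, measureReal_def,
    mul_inv_cancel_left₀ (ENNReal.toReal_ne_zero.2 ⟨hA0, measure_ne_top _ _⟩)]

lemma ae_norm_walk_le (hW : IsSwitchWalk μ d j lam N T V) {c t : ℝ} (hc : 0 < c) (ht : 0 < t)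
    (n : ℕ) : ∀ᵐ ω ∂μ.restrict (N t ⁻¹' {n}),
      ‖walkPosition c t n (fun k => T t k ω) fun k => V k ω‖ ≤ c * t := by
  have hA : MeasurableSet (N t ⁻¹' {n}) := hW.measurable_N t ht (measurableSet_singleton _)
  filter_upwards [ae_restrict_mem hA, ae_restrict_of_ae (hW.ae_mem_timeSimplex ht)] with ω h1 h2
  obtain rfl : N t ω = n := h1
  exact norm_walkPosition_le hc ht h2 _

/-- The integral of ⟨v, Z⟩^(2q) over the walk and over an auxiliary uniform direction v is evaluated
in both orders: v first gives a multiple of the moment of ‖Z‖, the walk first gives the Bessel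
coefficient of index (n + 1) h. -/
lemma setIntegral_norm_pow (hW : IsSwitchWalk μ d j lam N T V) (hd : 3 ≤ d) {c t : ℝ}
    (hc : 0 < c) (ht : 0 < t) (n q : ℕ) {h : ℝ} (hh : h = (d : ℝ) / 2 - 1) :
    ∫ ω in N t ⁻¹' {n},
        ‖walkPosition c t n (fun k => T t k ω) fun k => V k ω‖ ^ (2 * q) ∂μ =
      μ.real (N t ⁻¹' {n}) * ((c * t) ^ (2 * q) *
        (Real.Gamma ((n + 1) * h + 1) * Real.Gamma (h + q + 1) /
          (Real.Gamma (h + 1) * Real.Gamma ((n + 1) * h + q + 1)))) := by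
  have hd' : (3 : ℝ) ≤ d := by exact_mod_cast hd
  have hd0 : 0 < d := by omega
  have hpos : 0 < h := by rw [hh]; linarith
  have hG : (d : ℝ) / 2 = h + 1 := by rw [hh]; ring
  have := isProbabilityMeasure_uniformSphere hd0
  set Z : Ω → EuclideanSpace ℝ (Fin d) :=
    fun ω => walkPosition c t n (fun k => T t k ω) fun k => V k ω
  have hZm : Measurable Z := hW.measurable_walk c ht n
  have hZb : ∀ᵐ ω ∂μ.restrict (N t ⁻¹' {n}), ‖Z ω‖ ≤ c * t := hW.ae_norm_walk_le hc ht n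
  have hswap := integral_integral_swap (μ := μ.restrict (N t ⁻¹' {n})) (ν := uniformSphere d)
    (f := fun ω v => inner ℝ v.1 (Z ω) ^ (2 * q)) (.of_bound (by
      simp only [Function.uncurry_def]
      fun_prop) ((c * t) ^ (2 * q))
      ((Measure.quasiMeasurePreserving_fst.ae hZb).mono fun p hp => by
        simp only [Function.uncurry_def, norm_pow]
        refine pow_le_pow_left₀ (norm_nonneg _) ((norm_inner_le_norm _ _).trans ?_) _
        simpa using hp))
  have hin (v : Metric.sphere (0 : EuclideanSpace ℝ (Fin d)) 1) :=
    hW.integral_inner_pow hd0 hc ht n (2 * q) (norm_eq_of_mem_sphere v)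
  simp only [integral_inner_pow_uniformSphere' hd0, integral_mul_const, Z, hin, integral_const,
    probReal_univ, one_smul, hW.setIntegral_stepProductCoeff hd ht n (2 * q) hh, ← hh] at hswap
  rw [hG, besselCoeff_two_mul, besselCoeff_two_mul, besselCoeff, besselCoeff] at hswap
  simp only [Even.zero, if_true, Nat.zero_div, Nat.cast_zero, add_zero, pow_zero,
    Nat.factorial_zero, Nat.cast_one, one_mul] at hswap
  have g1 : 0 < Real.Gamma (h + 1) := Real.Gamma_pos_of_pos (by positivity)
  have g2 : 0 < Real.Gamma (h + q + 1) := Real.Gamma_pos_of_pos (by positivity)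
  have g3 : 0 < Real.Gamma ((n + 1) * h + q + 1) := Real.Gamma_pos_of_pos (by positivity)
  have g4 : 0 < Real.Gamma ((n + 1) * h + 1) := Real.Gamma_pos_of_pos (by positivity)
  have f1 := q.factorial_pos
  have f2 := (2 * q).factorial_pos
  have hK : (0 : ℝ) < (2 * q).factorial * (Real.Gamma (h + 1) *
    (1 / (2 ^ (2 * q) * (q.factorial * Real.Gamma (h + q + 1))))) := by positivity
  refine mul_right_cancel₀ hK.ne' (hswap.trans ?_)
  rw [mul_pow, one_div_pow]
  field_simp

lemma setIntegral_norm_rpow (hW : IsSwitchWalk μ d j lam N T V) (hd : 3 ≤ d) {c t : ℝ}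
    (hc : 0 < c) (ht : 0 < t) (n : ℕ) {p : ℝ} (hp : 0 ≤ p) {h : ℝ} (hh : h = (d : ℝ) / 2 - 1) :
    ∫ ω in N t ⁻¹' {n},
        ‖walkPosition c t n (fun k => T t k ω) fun k => V k ω‖ ^ p ∂μ =
      μ.real (N t ⁻¹' {n}) * ((c * t) ^ p *
        (Real.Gamma ((n + 1) * h + 1) * Real.Gamma (h + p / 2 + 1) /
          (Real.Gamma (h + 1) * Real.Gamma ((n + 1) * h + p / 2 + 1)))) := by
  have hd' : (3 : ℝ) ≤ d := by exact_mod_cast hd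
  have hpos : 0 < h := by rw [hh]; linarith
  have hct : 0 < c * t := by positivity
  have g1 : 0 < Real.Gamma (h + 1) := Real.Gamma_pos_of_pos (by positivity)
  have g2 : 0 < Real.Gamma (h + p / 2 + 1) := Real.Gamma_pos_of_pos (by positivity)
  -- For n = 0 the second Beta parameter n h degenerates; the distance is then exactly c t.
  obtain rfl | hn := Nat.eq_zero_or_pos n
  · have : ∀ ω, ‖walkPosition c t 0 (fun k => T t k ω) fun k => V k ω‖ = c * t := fun ω => by
      simp [walkPosition, norm_smul, abs_of_pos hc, abs_of_pos ht]
    simp only [this, setIntegral_const, smul_eq_mul, Nat.cast_zero, zero_add, one_mul]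
    field_simp
  have hn' : (0 : ℝ) < n := by exact_mod_cast hn
  have hnh : 0 < n * h := by positivity
  set Z : Ω → EuclideanSpace ℝ (Fin d) :=
    fun ω => walkPosition c t n (fun k => T t k ω) fun k => V k ω
  have hZm : Measurable Z := hW.measurable_walk c ht n
  let X : Ω → ℝ := fun ω => (‖Z ω‖ / (c * t)) ^ 2
  have hXm : Measurable X := by fun_prop
  have hbeta {s : ℝ} (hs : 0 ≤ s) : beta (h + 1 + s) (n * h) / beta (h + 1) (n * h) =
      Real.Gamma ((n + 1) * h + 1) * Real.Gamma (h + s + 1) /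
          (Real.Gamma (h + 1) * Real.Gamma ((n + 1) * h + s + 1)) := by
    have g3 : 0 < Real.Gamma (n * h) := Real.Gamma_pos_of_pos hnh
    have g4 : 0 < Real.Gamma ((n + 1) * h + s + 1) := Real.Gamma_pos_of_pos (by positivity)
    have g5 : 0 < Real.Gamma ((n + 1) * h + 1) := Real.Gamma_pos_of_pos (by positivity)
    rw [beta, beta, show h + 1 + s + n * h = (n + 1) * h + s + 1 by ring,
      show h + 1 + n * h = (n + 1) * h + 1 by ring, show h + 1 + s = h + s + 1 by ring]
    field_simp
  have := isProbabilityMeasureBeta (by positivity : 0 < h + 1) hnh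
  have : IsFiniteMeasure ((μ.restrict (N t ⁻¹' {n})).map X) := inferInstance
  have : IsFiniteMeasure (μ (N t ⁻¹' {n}) • betaMeasure (h + 1) (n * h)) :=
    Measure.smul_finite _ (measure_ne_top _ _)
  -- The squared relative distance is compared with a Beta(h + 1, n h) law of mass P(N t = n).
  -- Leaving both measures unnormalized covers the case of a null event.
  have key := integral_eq_of_moments_eq (ρ₁ := (μ.restrict (N t ⁻¹' {n})).map X)
    (ρ₂ := μ (N t ⁻¹' {n}) • betaMeasure (h + 1) (n * h)) ?_ ?_ ?_
    (Real.continuous_rpow_const (by positivity : 0 ≤ p / 2))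
  · rw [integral_map hXm.aemeasurable (by fun_prop), integral_smul_measure,
      integral_rpow_betaMeasure (by positivity) hnh (by positivity), hbeta (by positivity),
      smul_eq_mul, ← measureReal_def] at key
    have hX (ω) : ‖Z ω‖ ^ p = (c * t) ^ p * X ω ^ (p / 2) := by
      rw [← Real.rpow_natCast_mul (by positivity), show ((2 : ℕ) : ℝ) * (p / 2) = p by
        push_cast; ring, Real.div_rpow (norm_nonneg _) hct.le]
      field_simp
    change ∫ ω in N t ⁻¹' {n}, ‖Z ω‖ ^ p ∂μ = _
    simp only [hX, integral_const_mul, key]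
    ring
  · rw [ae_map_iff (p := fun x => x ∈ Set.Icc (0 : ℝ) 1) hXm.aemeasurable measurableSet_Icc]
    filter_upwards [hW.ae_norm_walk_le hc ht n] with ω hω
    exact ⟨by positivity, pow_le_one₀ (by positivity) ((div_le_one hct).2 hω)⟩
  · exact Measure.ae_smul_measure
      ((ae_mem_Ioo_betaMeasure _ _).mono fun x hx => Set.Ioo_subset_Icc_self hx) _
  · intro q
    have h1 := integral_rpow_betaMeasure (s := q) (by positivity : 0 < h + 1) hnh (by positivity)
    simp only [Real.rpow_natCast] at h1
    rw [integral_map hXm.aemeasurable (by fun_prop), integral_smul_measure, h1,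
      hbeta (by positivity), smul_eq_mul, ← measureReal_def]
    have hX (ω) : X ω ^ q = ((c * t) ^ (2 * q))⁻¹ * ‖Z ω‖ ^ (2 * q) := by
      rw [← pow_mul, div_pow]
      ring
    simp only [hX, integral_const_mul]
    rw [hW.setIntegral_norm_pow hd hc ht n q hh]
    field_simp

end IsSwitchWalk

/-! ### Summation over the number of deviations -/

theorem mainTheorem7 {Ω : Type*} [MeasurableSpace Ω] (μ : Measure Ω) [IsProbabilityMeasure μ]
    (d j : ℕ) (hd : 3 ≤ d) (c lam : ℝ) (hc : 0 < c) (hlam : 0 < lam)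
    (N : ℝ → Ω → ℕ) (T : ℝ → ℕ → Ω → ℝ)
    (V : ℕ → Ω → Metric.sphere (0 : EuclideanSpace ℝ (Fin d)) 1)
    (hW : IsSwitchWalk μ d j lam N T V) (t : ℝ) (ht : 0 < t) (p : ℝ) (hp : 1 ≤ p) :
    Integrable (fun ω => distanceProcess c N T V t ω ^ p) μ ∧
      ∫ ω, distanceProcess c N T V t ω ^ p ∂μ =
        (c * t) ^ p / mittagLefflerE ((d : ℝ) / 2 - 1) ((d : ℝ) / 2) (lam * t) *
          (Real.Gamma ((p + d) / 2) / Real.Gamma ((d : ℝ) / 2) * (lam * t) *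
              mittagLefflerE ((d : ℝ) / 2 - 1) ((d : ℝ) + p / 2 - 1) (lam * t) +
            1 / Real.Gamma ((d : ℝ) / 2)) := by
  have hNm := hW.measurable_N t ht
  have hA (n : ℕ) : MeasurableSet (N t ⁻¹' {n}) := hNm (measurableSet_singleton _)
  have hm : Measurable fun ω => distanceProcess c N T V t ω ^ p :=
    (hW.measurable_distanceProcess c ht).pow_const p
  have hint : Integrable (fun ω => distanceProcess c N T V t ω ^ p) μ := by
    refine .of_bound hm.aestronglyMeasurable ((c * t) ^ p) ?_
    filter_upwards [hW.ae_mem_timeSimplex ht] with ω hω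
    have h1 : distanceProcess c N T V t ω ≤ c * t := norm_walkPosition_le hc ht hω _
    have h0 : 0 ≤ distanceProcess c N T V t ω := norm_nonneg _
    rw [Real.norm_of_nonneg (by positivity)]
    exact Real.rpow_le_rpow h0 h1 (by linarith)
  refine ⟨hint, ?_⟩
  have hU : ⋃ n, N t ⁻¹' {n} = Set.univ := by
    ext ω
    simp
  -- Convergence of the series comes from the integrability of the bounded distance, not from Gamma
  -- asymptotics.
  have hsum := hasSum_integral_iUnion (μ := μ) hA (pairwise_disjoint_fiber (N t))
    (f := fun ω => distanceProcess c N T V t ω ^ p) hint.integrableOn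
  rw [hU, setIntegral_univ] at hsum
  set E := mittagLefflerE ((d : ℝ) / 2 - 1) ((d : ℝ) / 2) (lam * t) with hE
  set h : ℝ := (d : ℝ) / 2 - 1 with hh
  have hd' : (3 : ℝ) ≤ d := by exact_mod_cast hd
  have hpos : 0 < h := by rw [hh]; linarith
  have hd2 : (d : ℝ) / 2 = h + 1 := by rw [hh]; ring
  have g1 : 0 < Real.Gamma (h + 1) := Real.Gamma_pos_of_pos (by positivity)
  have g2 : 0 < Real.Gamma (h + p / 2 + 1) := Real.Gamma_pos_of_pos (by positivity)
  have hterm (n : ℕ) : ∫ ω in N t ⁻¹' {n}, distanceProcess c N T V t ω ^ p ∂μ =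
      (c * t) ^ p / E * (Real.Gamma (h + p / 2 + 1) / Real.Gamma (h + 1)) *
        ((lam * t) ^ n / Real.Gamma ((n + 1) * h + p / 2 + 1)) := by
    have h1 : ∫ ω in N t ⁻¹' {n}, distanceProcess c N T V t ω ^ p ∂μ =
        ∫ ω in N t ⁻¹' {n},
          ‖walkPosition c t n (fun k => T t k ω) fun k => V k ω‖ ^ p ∂μ := by
      refine setIntegral_congr_fun (hA n) fun ω hω => ?_
      obtain rfl : N t ω = n := hω
      rfl
    have g3 : 0 < Real.Gamma ((n + 1) * h + 1) := Real.Gamma_pos_of_pos (by positivity)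
    rw [h1, hW.setIntegral_norm_rpow hd hc ht n (by linarith) hh, hW.law_N t ht n, ← hE, ← hh, hd2,
      show n * h + (h + 1) = (n + 1) * h + 1 by ring]
    field_simp
  simp only [hterm] at hsum
  -- The term n = 0 yields the isolated 1/Γ(d/2). In the shifted terms (n + 2) h + p/2 + 1 = h n + d
  -- + p/2 - 1, as 2 h = d - 2.
  rw [← hasSum_nat_add_iff' 1] at hsum
  simp only [Finset.sum_range_one, pow_zero, Nat.cast_zero, zero_add, one_mul] at hsum
  have htail (n : ℕ) : (c * t) ^ p / E * (Real.Gamma (h + p / 2 + 1) / Real.Gamma (h + 1)) *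
        ((lam * t) ^ (n + 1) / Real.Gamma (((n + 1 : ℕ) + 1) * h + p / 2 + 1)) =
      (c * t) ^ p / E * (Real.Gamma (h + p / 2 + 1) / Real.Gamma (h + 1)) * (lam * t) *
        ((lam * t) ^ n / Real.Gamma (h * n + (d + p / 2 - 1))) := by
    rw [show ((n + 1 : ℕ) + 1 : ℝ) * h + p / 2 + 1 = h * n + (d + p / 2 - 1) by
      push_cast; rw [hh]; ring, pow_succ]
    ring
  simp only [htail] at hsum
  have hval := hsum.tsum_eq
  rw [tsum_mul_left] at hval
  rw [sub_eq_iff_eq_add.1 hval.symm, mittagLefflerE, hd2,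
    show (p + d) / 2 = h + p / 2 + 1 by rw [hh]; ring]
  field_simp
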